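/- Let $p\ge 2$ be an integer and consider the generalized BBM equation $$(1-\partial_x^2)u_t+(u+u^p)_x=0,\qquad (t,x)\in\mathbb R\times\mathbb R,$$ for real-valued $u$. A global solution with data $u_0\in H^1=H^1(\mathbb R)$ is a function $u\in C(\mathbb R,H^1)$ with $u(0)=u_0$ that satisfies the equation at every time in the sense of distributions in $x$, i.e. $\frac{d}{dt}\int (u\phi+u_x\phi')\,dx=\int (u+u^p)\phi'\,dx$ for all $t\in\mathbb R$ and $\phi\in C_c^\infty(\mathbb R)$. Norms are $\|w\|_{H^1(I)}^2=\int_I (w^2+w_x^2)\,dx$. Let $b>0$. There is $\varepsilon_1=\varepsilon_1(p,b)>0$ such that: (i) every global solution $u$ with $\|u_0\|_{H^1}<\varepsilon_1$ satisfies $\lim_{t\to\infty}\|u(t)\|_{H^1(((1+b)t,\infty))}=0$; (ii) for every $c_0>0$ there is $C=C(p,b,c_0)>0$ such that, for $\sigma=-(1+b)$, all $\varepsilon\in(0,\varepsilon_1]$ and every global solution $u$ with $\|u_0\|_{H^1}<\varepsilon$, $$\int_2^\infty\!\!\int_{\mathbb R} e^{-c_0|x+\sigma t|}\,(u^2+u_x^2)(t,x)\,dx\,dt\le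 C\varepsilon^2 .$$ Moreover, for every $a>\frac18$ there is $\varepsilon_0=\varepsilon_0(p,a,b)\in(0,\varepsilon_1]$ such that, with $I(t)=(-\infty,-at)\cup((1+b)t,\infty)$: (iii) every global solution $u$ with $\|u_0\|_{H^1}<\varepsilon_0$ satisfies $\lim_{t\to\infty}\|u(t)\|_{H^1(I(t))}=0$; (iv) for every $c_0>0$ there is $C=C(p,a,b,c_0)>0$ such that the bound in (ii) holds for all $\sigma\ge a$, all $\varepsilon\in(0,\varepsilon_0]$ and every global solution $u$ with $\|u_0\|_{H^1}<\varepsilon$. -/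

import Mathlib

open MeasureTheory Filter Topology
open scoped ContDiff ENNReal

namespace BBM

/-- Test functions on the line: real-valued, smooth, with compact support. -/
structure IsTest (φ : ℝ → ℝ) : Prop where
  smooth : ContDiff ℝ ∞ φ
  compact : HasCompactSupport φ

lemma IsTest.memLp {φ : ℝ → ℝ} (h : IsTest φ) : MemLp φ 2 (volume : Measure ℝ) :=
  h.smooth.continuous.memLp_of_hasCompactSupport h.compact

lemma IsTest.deriv {φ : ℝ → ℝ} (h : IsTest φ) : IsTest (deriv φ) :=
  ⟨(contDiff_infty_iff_deriv.1 h.smooth).2, h.compact.deriv⟩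

lemma IsTest.integrable_mul {φ : ℝ → ℝ} (h : IsTest φ) (f : Lp ℝ 2 (volume : Measure ℝ)) :
    Integrable (fun x => f x * φ x) volume :=
  (Lp.memLp f).integrable_mul h.memLp

/-- The real Sobolev space `H¹(ℝ)`: pairs `(u, u')` of `L²` functions such that `u'` is the weak
derivative of `u`, with the norm `‖u‖² = ‖u‖²_{L²} + ‖u'‖²_{L²}` inherited from the Hilbert sum. -/
noncomputable def H1 :
    Submodule ℝ (WithLp 2 (Lp ℝ 2 (volume : Measure ℝ) × Lp ℝ 2 (volume : Measure ℝ))) where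
  carrier := {w | ∀ φ : ℝ → ℝ, IsTest φ → ∫ x, w.fst x * deriv φ x = - ∫ x, w.snd x * φ x}
  zero_mem' := by
    intro φ _
    have h : ((0 : Lp ℝ 2 (volume : Measure ℝ)) : ℝ → ℝ) =ᵐ[volume] 0 := Lp.coeFn_zero _ _ _
    have h1 (ψ : ℝ → ℝ) : ∫ x, (0 : Lp ℝ 2 (volume : Measure ℝ)) x * ψ x = 0 := by
      rw [← integral_zero ℝ ℝ (μ := volume)]
      refine integral_congr_ae ?_
      filter_upwards [h] with x hx
      simp only [hx, Pi.zero_apply, zero_mul]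
    rw [WithLp.zero_fst, WithLp.zero_snd, h1, h1, neg_zero]
  add_mem' := by
    intro v w hv hw φ hφ
    have h1 (f g : Lp ℝ 2 (volume : Measure ℝ)) {ψ : ℝ → ℝ} (hψ : IsTest ψ) :
        ∫ x, (f + g) x * ψ x = (∫ x, f x * ψ x) + ∫ x, g x * ψ x := by
      rw [← integral_add (hψ.integrable_mul f) (hψ.integrable_mul g)]
      refine integral_congr_ae ?_
      filter_upwards [Lp.coeFn_add f g] with x hx
      rw [hx, Pi.add_apply, add_mul]
    rw [WithLp.add_fst, WithLp.add_snd, h1 _ _ hφ.deriv, h1 _ _ hφ, hv φ hφ, hw φ hφ]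
    ring
  smul_mem' := by
    intro c w hw φ hφ
    have h1 (f : Lp ℝ 2 (volume : Measure ℝ)) (ψ : ℝ → ℝ) :
        ∫ x, (c • f) x * ψ x = c * ∫ x, f x * ψ x := by
      rw [← integral_const_mul]
      refine integral_congr_ae ?_
      filter_upwards [Lp.coeFn_smul c f] with x hx
      rw [hx, Pi.smul_apply, smul_eq_mul, mul_assoc]
    rw [WithLp.smul_fst, WithLp.smul_snd, h1, h1, hw φ hφ]
    ring

/-- The underlying function of an element of `H¹(ℝ)` (defined up to null sets). -/
noncomputable def fn (w : H1) : ℝ → ℝ := w.1.fst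

/-- The weak derivative of an element of `H¹(ℝ)` (defined up to null sets). -/
noncomputable def dx (w : H1) : ℝ → ℝ := w.1.snd

/-- The norm `‖w‖_{H¹(I)} = (∫_I w² + w_x²)^{1/2}` of the restriction of `w ∈ H¹(ℝ)` to `I`. -/
noncomputable def normOn (I : Set ℝ) (w : H1) : ℝ :=
  Real.sqrt (∫ x in I, (fn w x ^ 2 + dx w x ^ 2))

/-- `u ∈ C(ℝ, H¹)` is a global solution of `(1 - ∂ₓ²) u_t + (u + u^p)_x = 0` with `u(0) = u₀`.
The equation holds at every time in the sense of distributions in `x`: for every test function `φ`,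
`d/dt ∫ (u φ + u_x φ') dx = ∫ (u + u^p) φ' dx`. -/
structure IsGlobalSolution (p : ℕ) (u₀ : H1) (u : ℝ → H1) : Prop where
  continuous : Continuous u
  initial : u 0 = u₀
  equation : ∀ φ : ℝ → ℝ, IsTest φ → ∀ t : ℝ,
    HasDerivAt (fun s : ℝ => ∫ x, (fn (u s) x * φ x + dx (u s) x * deriv φ x))
      (∫ x, (fn (u t) x + fn (u t) x ^ p) * deriv φ x) t

/-- The region `(-∞, -a t) ∪ ((1 + b) t, ∞)`. -/
def region (a b t : ℝ) : Set ℝ := Set.Iio (-a * t) ∪ Set.Ioi ((1 + b) * t)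

/-- The space-time integral `∫_2^∞ ∫ e^{-c₀ |x + σ t|} (u² + u_x²)(t, x) dx dt` in `[0, ∞]`. -/
noncomputable def localEnergy (c₀ σ : ℝ) (u : ℝ → H1) : ℝ≥0∞ :=
  ∫⁻ t in Set.Ioi (2 : ℝ), ∫⁻ x : ℝ,
    ENNReal.ofReal (Real.exp (-c₀ * |x + σ * t|) * (fn (u t) x ^ 2 + dx (u t) x ^ 2))

end BBM

/-! Write the equation as `u_t = -F_x` with `F = (1 - ∂ₓ²)⁻¹(u + u^p)`. For a weight `ψ` travelling
along `x + σt + c`, three integrations by parts turn the time derivative of `∫ ψ (u² + u_x²)` into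
the virial form `∫ ψ' (σ(u² + u_x²) + 2uF - u² - 2/(p+1) u^(p+1))`, with no second derivative of `u`
(`IsGlobalSolution.hasDerivAt_virial`). The choice `ψ = 1` conserves the `H¹` norm, so a small
solution stays small in `L^∞` and the nonlinear part of the form is a perturbation.

Everything rests on the sign of the linear part, with `f = (1 - ∂ₓ²)⁻¹u` and `ψ'` slowly varying. On
the right, `2uf - u² ≤ f²`, and the resolvent is almost a contraction in weighted `L²`, so `σ ≤
-(1+b)` makes the form negative (`IsSlowWeight.virial_le`). On the left, adding the exact
derivatives `-(u f_x)'` and `2(f f_x)'` changes `2uf - u²` into `-(uf + u_x f_x) + 2(f² + f_x²)`.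
What remains is `σu² - uf + 2f²` in `(u, f)` and again in `(u_x, f_x)`, positive definite exactly
when `σ > 1/8` (`quadratic_form_coercive`, `IsSlowWeight.le_virial`).

Take `ψ = arctan(δ ·)`. Integrating the signed form in time bounds the local energy, because `ψ'`
dominates any decaying exponential (`Dissipative.localEnergy_le`). For the limits, monotonicity is
used along a line of slightly smaller speed: a weight centred at the edge of the region at time `T`
started at time `0` at a point going to infinity with `T`, where the data carry vanishing energy
(`Dissipative.tendsto_normOn`). -/

namespace BBM

/-! ### Locally absolutely continuous functions on the line -/

/-- `g` is locally absolutely continuous on the line with almost everywhere derivative `g'`. -/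
structure HasACDeriv (g g' : ℝ → ℝ) : Prop where
  ac : ∀ a b, AbsolutelyContinuousOnInterval g a b
  ae_hasDerivAt : ∀ᵐ x, HasDerivAt g (g' x) x

namespace HasACDeriv

variable {g g' h h' : ℝ → ℝ}

lemma integral_eq_sub (hg : HasACDeriv g g') (a b : ℝ) : ∫ x in a..b, g' x = g b - g a := by
  rw [← (hg.ac a b).integral_deriv_eq_sub]
  refine intervalIntegral.integral_congr_ae ?_
  filter_upwards [hg.ae_hasDerivAt] with x hx _
  exact hx.deriv.symm

lemma continuous (hg : HasACDeriv g g') : Continuous g := by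
  refine continuous_iff_continuousAt.2 fun x => ?_
  have := (hg.ac (x - 1) (x + 1)).continuousOn
  refine this.continuousAt ?_
  rw [Set.uIcc_of_le (by linarith)]
  exact Icc_mem_nhds (by linarith) (by linarith)

lemma mul (hg : HasACDeriv g g') (hh : HasACDeriv h h') :
    HasACDeriv (fun x => g x * h x) (fun x => g' x * h x + g x * h' x) where
  ac a b := (hg.ac a b).mul (hh.ac a b)
  ae_hasDerivAt := by
    filter_upwards [hg.ae_hasDerivAt, hh.ae_hasDerivAt] with x h1 h2
    exact h1.mul h2

lemma add_const (hg : HasACDeriv g g') (c : ℝ) : HasACDeriv (fun x => g x + c) g' where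
  ac a b := (hg.ac a b).add
    ((LipschitzWith.const c).lipschitzOnWith.absolutelyContinuousOnInterval (K := 0))
  ae_hasDerivAt := by
    filter_upwards [hg.ae_hasDerivAt] with x h1
    exact h1.add_const c

lemma pow (hg : HasACDeriv g g') (n : ℕ) :
    HasACDeriv (fun x => g x ^ (n + 1)) (fun x => (n + 1) * g x ^ n * g' x) where
  ac a b := by
    induction n with
    | zero => simpa using hg.ac a b
    | succ n ih =>
      have := ih.mul (hg.ac a b)
      exact this
  ae_hasDerivAt := by
    filter_upwards [hg.ae_hasDerivAt] with x h1
    simpa using h1.fun_pow (n + 1)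

lemma of_hasDerivAt (hg : ∀ x, HasDerivAt g (g' x) x) (hc : Continuous g') : HasACDeriv g g' where
  ac a b := by
    have h1 : deriv g = g' := funext fun x => (hg x).deriv
    have : ContDiff ℝ 1 g := contDiff_one_iff_deriv.2 ⟨fun x => (hg x).differentiableAt, h1 ▸ hc⟩
    exact this.contDiffOn.absolutelyContinuousOnInterval
  ae_hasDerivAt := ae_of_all _ hg

/-- The integral is the limit of `g R - g (-R)`, which is itself an integrable function of `R`; such
a function can only converge to `0`. No decay of `g` has to be known beforehand. -/
lemma integral_eq_zero (hg : HasACDeriv g g') (h0 : Integrable g) (h1 : Integrable g') :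
    ∫ x, g' x = 0 := by
  have hl : Tendsto (fun R : ℝ => g R - g (-R)) atTop (𝓝 (∫ x, g' x)) := by
    have := intervalIntegral_tendsto_integral h1 tendsto_neg_atTop_atBot tendsto_id
    refine this.congr fun R => ?_
    rw [hg.integral_eq_sub]; rfl
  have hint : Integrable (fun R : ℝ => g R - g (-R)) := h0.sub h0.comp_neg
  refine IntegrableAtFilter.eq_zero_of_tendsto (μ := volume) (l := atTop)
    ⟨Set.univ, univ_mem, hint.integrableOn⟩ ?_ hl
  intro s hs
  obtain ⟨b, hb⟩ := mem_atTop_sets.1 hs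
  rw [← top_le_iff, ← Real.volume_Ici (a := b)]
  exact measure_mono hb

/-- Since `(g²)' = 2gg' ≤ g² + g'²`, two values of `g²` differ by at most the integral. If one value
exceeded it, `g²` would stay above a positive constant on the whole line and could not be
integrable. -/
lemma sq_le_integral (hg : HasACDeriv g g') (h0 : MemLp g 2) (h1 : MemLp g' 2) (x : ℝ) :
    g x ^ 2 ≤ ∫ y, (g y ^ 2 + g' y ^ 2) := by
  have hi : Integrable (fun y => g y ^ 2 + g' y ^ 2) := h0.integrable_sq.add h1.integrable_sq
  by_contra! hlt
  set N := ∫ y, (g y ^ 2 + g' y ^ 2)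
  have key : ∀ y, g x ^ 2 - N ≤ g y ^ 2 := by
    intro y
    have h2 := (hg.pow 1).integral_eq_sub y x
    have h3 : ∫ z in y..x, ((1 : ℕ) + 1 : ℝ) * g z ^ 1 * g' z ≤ N := by
      refine (le_abs_self _).trans ?_
      rw [← Real.norm_eq_abs]
      refine intervalIntegral.norm_integral_le_integral_norm_uIoc.trans ?_
      refine (setIntegral_mono_on (g := fun y => g y ^ 2 + g' y ^ 2) ?_ hi.integrableOn
        measurableSet_uIoc ?_).trans
        (setIntegral_le_integral hi (ae_of_all _ fun _ => by positivity))
      · refine Integrable.integrableOn (Integrable.norm ?_)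
        have := (h0.integrable_mul h1).const_mul 2
        refine this.congr (ae_of_all _ fun z => ?_)
        simp only [Pi.mul_apply]; push_cast; ring
      · intro z _
        rw [Real.norm_eq_abs, abs_le]
        push_cast
        constructor <;> nlinarith [sq_nonneg (g z + g' z), sq_nonneg (g z - g' z)]
    norm_num at h2 h3
    linarith
  have hc : Integrable (fun _ : ℝ => g x ^ 2 - N) := by
    refine h0.integrable_sq.mono' aestronglyMeasurable_const (ae_of_all _ fun y => ?_)
    rw [Real.norm_of_nonneg (by linarith)]
    exact key y
  rcases integrable_const_iff.1 hc with h | h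
  · linarith
  · have := h.measure_univ_lt_top
    simp at this

end HasACDeriv

/-! ### The continuous representative of an element of `H¹(ℝ)` -/

lemma exists_isTest_deriv_eq {θ : ℝ → ℝ} (hθ : IsTest θ) (h0 : ∫ x, θ x = 0) :
    ∃ Φ, IsTest Φ ∧ deriv Φ = θ := by
  obtain ⟨R, hR⟩ := hθ.compact.isCompact.isBounded.subset_closedBall 0
  have hz : ∀ x, R < |x| → θ x = 0 := by
    intro x hx
    refine image_eq_zero_of_notMem_tsupport fun h => ?_
    have := hR h
    simp at this
    linarith
  have hc := hθ.smooth.continuous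
  have hi : Integrable θ := hc.integrable_of_hasCompactSupport hθ.compact
  have hd : ∀ x, HasDerivAt (fun y => ∫ z in Set.Iic y, θ z) (θ x) x := by
    intro x
    have h1 : ∀ y, ∫ z in Set.Iic y, θ z = (∫ z in Set.Iic x, θ z) + ∫ z in x..y, θ z := by
      intro y
      have := intervalIntegral.integral_Iic_sub_Iic (f := θ) (μ := volume) (a := x) (b := y)
        hi.integrableOn hi.integrableOn
      linarith
    rw [funext h1]
    exact (intervalIntegral.integral_hasDerivAt_right (hc.intervalIntegrable _ _)
      hc.stronglyMeasurable.stronglyMeasurableAtFilter hc.continuousAt).const_add _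
  have hde : deriv (fun y => ∫ z in Set.Iic y, θ z) = θ := funext fun x => (hd x).deriv
  refine ⟨fun y => ∫ z in Set.Iic y, θ z, ⟨?_, ?_⟩, hde⟩
  · exact contDiff_infty_iff_deriv.2 ⟨fun x => (hd x).differentiableAt,
      by rw [hde]; exact hθ.smooth⟩
  · refine HasCompactSupport.intro (isCompact_closedBall (0 : ℝ) (|R|)) fun x hx => ?_
    simp only [Metric.mem_closedBall, dist_zero_right, Real.norm_eq_abs, not_le] at hx
    have hRx : R < |x| := (le_abs_self R).trans_lt hx
    rcases le_total 0 x with h | h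
    · rw [← h0]
      refine setIntegral_eq_integral_of_forall_compl_eq_zero fun y hy => hz y ?_
      simp only [Set.mem_Iic, not_le] at hy
      rw [abs_of_nonneg h] at hRx
      rw [abs_of_nonneg (by linarith)]
      linarith
    · refine setIntegral_eq_zero_of_forall_eq_zero fun y hy => hz y ?_
      simp only [Set.mem_Iic] at hy
      rw [abs_of_nonpos h] at hRx
      rw [abs_of_nonpos (by linarith)]
      linarith

/-- The du Bois-Reymond lemma: a function with vanishing weak derivative is constant. -/
lemma ae_eq_const_of_integral_mul_deriv_eq_zero {h : ℝ → ℝ} (hh : LocallyIntegrable h)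
    (H : ∀ φ, IsTest φ → ∫ x, h x * deriv φ x = 0) : ∃ c : ℝ, ∀ᵐ x, h x = c := by
  let η₀ : ContDiffBump (0 : ℝ) := ⟨1, 2, one_pos, one_lt_two⟩
  let η : ℝ → ℝ := η₀.normed volume
  have hη : IsTest η := ⟨η₀.contDiff_normed, η₀.hasCompactSupport_normed⟩
  have hη1 : ∫ x, η x = 1 := η₀.integral_normed
  have hint : ∀ {ψ : ℝ → ℝ}, IsTest ψ → Integrable ψ := fun hψ =>
    hψ.smooth.continuous.integrable_of_hasCompactSupport hψ.compact
  have hinth : ∀ {ψ : ℝ → ℝ}, IsTest ψ → Integrable (fun x => h x * ψ x) := fun {ψ} hψ => by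
    have := hh.integrable_smul_left_of_hasCompactSupport hψ.smooth.continuous hψ.compact
    exact this.congr (ae_of_all _ fun x => by simp [mul_comm])
  refine ⟨∫ x, h x * η x, ?_⟩
  refine ae_eq_of_integral_contDiff_smul_eq hh (locallyIntegrable_const _) fun ψ h1 h2 => ?_
  have hψ : IsTest ψ := ⟨h1, h2⟩
  -- Only test functions of mean zero are derivatives of test functions, so the mean of `ψ` is first
  -- removed by a multiple of the fixed unit-mass `η`.
  set m := ∫ x, ψ x with hm
  have hmη : IsTest (fun x => m * η x) := ⟨contDiff_const.mul hη.smooth, hη.compact.mul_left⟩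
  have hθ : IsTest (fun x => ψ x - m * η x) :=
    ⟨h1.sub hmη.smooth, h2.sub hmη.compact⟩
  obtain ⟨Φ, hΦ, hΦ'⟩ := exists_isTest_deriv_eq hθ (by
    rw [integral_sub (hint hψ) (hint hmη), integral_const_mul, hη1]; simp [hm])
  have h3 := H Φ hΦ
  rw [hΦ'] at h3
  have h4 : ∫ x, h x * (ψ x - m * η x) = (∫ x, h x * ψ x) - m * ∫ x, h x * η x := by
    rw [← integral_const_mul, ← integral_sub (hinth hψ) ((hinth hη).const_mul m)]
    congr 1; ext x; ring
  simp only [smul_eq_mul]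
  rw [integral_mul_const, ← hm]
  simp_rw [mul_comm (ψ _)]
  linarith

lemma memLp_fn (w : H1) : MemLp (fn w) 2 := Lp.memLp _

lemma memLp_dx (w : H1) : MemLp (dx w) 2 := Lp.memLp _

lemma integral_fn_mul_deriv (w : H1) {φ : ℝ → ℝ} (hφ : IsTest φ) :
    ∫ x, fn w x * deriv φ x = - ∫ x, dx w x * φ x := w.2 φ hφ

/-- Subtracting a primitive of the weak derivative leaves a function with zero weak derivative,
hence a constant. -/
theorem exists_hasACDeriv (w : H1) : ∃ g : ℝ → ℝ, fn w =ᵐ[volume] g ∧ HasACDeriv g (dx w) := by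
  have hli : LocallyIntegrable (dx w) := (memLp_dx w).locallyIntegrable (by norm_num)
  have hii : ∀ a b, IntervalIntegrable (dx w) volume a b := fun a b =>
    intervalIntegrable_iff.mpr <|
      (hli.integrableOn_isCompact isCompact_uIcc).mono_set Set.uIoc_subset_uIcc
  let g₀ : ℝ → ℝ := fun x => ∫ t in (0 : ℝ)..x, dx w t
  have hg₀ : HasACDeriv g₀ (dx w) := by
    refine ⟨fun a b => ?_, ?_⟩
    · refine AbsolutelyContinuousOnInterval.mono (a := min 0 (min a b)) (b := max 0 (max a b))
        ((hii _ _).absolutelyContinuousOnInterval_intervalIntegral ?_) ?_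
      · rw [Set.uIcc_of_le (by simp)]; simp
      · rw [Set.uIcc_of_le (a := min 0 (min a b)) (by simp)]
        exact Set.Icc_subset_Icc (by simp) (by simp)
    · filter_upwards [LocallyIntegrable.ae_hasDerivAt_integral hli] with x hx
      exact hx 0
  have hl : LocallyIntegrable (fun x => fn w x - g₀ x) :=
    ((memLp_fn w).locallyIntegrable (by norm_num)).sub hg₀.continuous.locallyIntegrable
  obtain ⟨c, hc⟩ := ae_eq_const_of_integral_mul_deriv_eq_zero hl fun φ hφ => by
    have hφd : ∀ x, HasDerivAt φ (deriv φ x) x := fun x =>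
      (hφ.smooth.differentiable (by simp) x).hasDerivAt
    have h1 := hg₀.mul (HasACDeriv.of_hasDerivAt hφd hφ.deriv.smooth.continuous)
    have hi1 : Integrable (fun x => dx w x * φ x) := hφ.integrable_mul _
    have hi2 : Integrable (fun x => g₀ x * deriv φ x) :=
      (hg₀.continuous.mul hφ.deriv.smooth.continuous).integrable_of_hasCompactSupport
        hφ.deriv.compact.mul_left
    have h2 := h1.integral_eq_zero
      ((hg₀.continuous.mul hφ.smooth.continuous).integrable_of_hasCompactSupport
        hφ.compact.mul_left) (hi1.add hi2)
    rw [integral_add hi1 hi2] at h2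
    have h3 := integral_fn_mul_deriv w hφ
    have h4 : ∫ x, (fn w x - g₀ x) * deriv φ x
        = (∫ x, fn w x * deriv φ x) - ∫ x, g₀ x * deriv φ x := by
      have hi3 : Integrable (fun x => fn w x * deriv φ x) := hφ.deriv.integrable_mul _
      rw [← integral_sub hi3 hi2]
      congr 1; ext x; ring
    linarith
  refine ⟨fun x => g₀ x + c, ?_, hg₀.add_const c⟩
  filter_upwards [hc] with x hx
  linarith

lemma norm_sq_eq (w : H1) : ‖w‖ ^ 2 = ∫ x, (fn w x ^ 2 + dx w x ^ 2) := by
  have h (f : Lp ℝ 2 (volume : Measure ℝ)) : ‖f‖ ^ 2 = ∫ x, f x ^ 2 := by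
    rw [← real_inner_self_eq_norm_sq, L2.inner_def]
    congr 1; ext x; simp [sq]
  rw [Submodule.coe_norm, WithLp.prod_norm_sq_eq_of_L2, h, h]
  exact (integral_add (memLp_fn w).integrable_sq (memLp_dx w).integrable_sq).symm

/-- Sobolev embedding into `L^∞` with constant `1`; through it smallness in `H¹` makes the
nonlinearity a perturbation. -/
lemma ae_abs_fn_le (w : H1) : ∀ᵐ x, |fn w x| ≤ ‖w‖ := by
  obtain ⟨g, h1, h2⟩ := exists_hasACDeriv w
  filter_upwards [h1] with x hx
  have h3 := h2.sq_le_integral ((memLp_fn w).ae_eq h1) (memLp_dx w) x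
  have h4 : ∫ y, (g y ^ 2 + dx w y ^ 2) = ‖w‖ ^ 2 := by
    rw [norm_sq_eq]
    refine integral_congr_ae ?_
    filter_upwards [h1] with y hy
    rw [hy]
  rw [hx]
  exact abs_le_of_sq_le_sq (h3.trans_eq h4) (norm_nonneg _)

/-- A bounded `C¹` function with bounded derivative. -/
structure IsWeight (ρ ρ' : ℝ → ℝ) (K : ℝ) : Prop where
  hasDerivAt : ∀ x, HasDerivAt ρ (ρ' x) x
  continuous_deriv : Continuous ρ'
  abs_le : ∀ x, |ρ x| ≤ K
  abs_deriv_le : ∀ x, |ρ' x| ≤ K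

lemma IsWeight.continuous {ρ ρ' : ℝ → ℝ} {K : ℝ} (h : IsWeight ρ ρ' K) : Continuous ρ :=
  continuous_iff_continuousAt.2 fun x => (h.hasDerivAt x).continuousAt

lemma integrable_mul_mul {m f g : ℝ → ℝ} {K : ℝ} (hm : Continuous m) (hK : ∀ x, |m x| ≤ K)
    (hf : MemLp f 2) (hg : MemLp g 2) : Integrable (fun x => m x * (f x * g x)) :=
  (hf.integrable_mul hg).bdd_mul hm.aestronglyMeasurable (ae_of_all _ hK)

/-- Integration by parts: the integral of the derivative of `ρ v w` vanishes. -/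
theorem integral_weight_mul_mul {ρ ρ' : ℝ → ℝ} {K : ℝ} (hρ : IsWeight ρ ρ' K) (v w : H1) :
    ∫ x, (ρ' x * (fn v x * fn w x) + ρ x * (dx v x * fn w x + fn v x * dx w x)) = 0 := by
  obtain ⟨g, hg, hg'⟩ := exists_hasACDeriv v
  obtain ⟨h, hh, hh'⟩ := exists_hasACDeriv w
  have h1 := (HasACDeriv.of_hasDerivAt hρ.hasDerivAt hρ.continuous_deriv).mul (hg'.mul hh')
  have e : (fun x => ρ' x * (fn v x * fn w x) + ρ x * (dx v x * fn w x + fn v x * dx w x))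
      =ᵐ[volume] fun x => ρ' x * (g x * h x) + ρ x * (dx v x * h x + g x * dx w x) := by
    filter_upwards [hg, hh] with x hx hy
    rw [hx, hy]
  have mg := (memLp_fn v).ae_eq hg
  have mh := (memLp_fn w).ae_eq hh
  rw [integral_congr_ae e]
  refine h1.integral_eq_zero (integrable_mul_mul hρ.continuous hρ.abs_le mg mh) ?_
  refine (integrable_mul_mul hρ.continuous_deriv hρ.abs_deriv_le mg mh).add ?_
  have := (integrable_mul_mul hρ.continuous hρ.abs_le (memLp_dx v) mh).add
    (integrable_mul_mul hρ.continuous hρ.abs_le mg (memLp_dx w))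
  exact this.congr (ae_of_all _ fun x => by simp [mul_add])

lemma memLp_fn_pow (v : H1) (n : ℕ) : MemLp (fun x => fn v x ^ (n + 1)) 2 := by
  refine MemLp.of_le_mul (c := ‖v‖ ^ n) (memLp_fn v) ((memLp_fn v).1.pow _) ?_
  filter_upwards [ae_abs_fn_le v] with x hx
  rw [pow_succ, norm_mul, norm_pow]
  gcongr
  exact hx

/-- Integration by parts: the integral of the derivative of `ρ v ^ (n + 2)` vanishes. -/
theorem integral_weight_mul_pow {ρ ρ' : ℝ → ℝ} {K : ℝ} (hρ : IsWeight ρ ρ' K) (v : H1) (n : ℕ) :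
    ∫ x, (ρ' x * fn v x ^ (n + 2) + ρ x * ((n + 2) * fn v x ^ (n + 1) * dx v x)) = 0 := by
  obtain ⟨g, hg, hg'⟩ := exists_hasACDeriv v
  have h1 := (HasACDeriv.of_hasDerivAt hρ.hasDerivAt hρ.continuous_deriv).mul (hg'.pow (n + 1))
  have e : (fun x => ρ' x * fn v x ^ (n + 2) + ρ x * ((n + 2) * fn v x ^ (n + 1) * dx v x))
      =ᵐ[volume] fun x => ρ' x * g x ^ (n + 1 + 1)
        + ρ x * (((n + 1 : ℕ) + 1) * g x ^ (n + 1) * dx v x) := by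
    filter_upwards [hg] with x hx
    rw [hx]; push_cast; ring
  have mg := (memLp_fn v).ae_eq hg
  have mp : MemLp (fun x => g x ^ (n + 1)) 2 := (memLp_fn_pow v n).ae_eq (by
    filter_upwards [hg] with x hx
    rw [hx])
  rw [integral_congr_ae e]
  refine h1.integral_eq_zero ?_ (.add ?_ ?_)
  · exact (integrable_mul_mul hρ.continuous hρ.abs_le mp mg).congr
      (ae_of_all _ fun x => by simp only; ring)
  · exact (integrable_mul_mul hρ.continuous_deriv hρ.abs_deriv_le mp mg).congr
      (ae_of_all _ fun x => by simp only; ring)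
  · exact ((integrable_mul_mul hρ.continuous hρ.abs_le mp (memLp_dx v)).const_mul
      ((n + 1 : ℕ) + 1)).congr (ae_of_all _ fun x => by simp only; ring)

/-! ### The Hilbert space `H¹(ℝ)` and the resolvent of `-∂ₓ²` -/

/-- The real Hilbert space `L²(ℝ)`. -/
abbrev L2R : Type := Lp ℝ 2 (volume : Measure ℝ)

lemma inner_L2_eq (f g : L2R) : inner ℝ f g = ∫ x, f x * g x := by
  rw [L2.inner_def]
  congr 1; ext x; simp [mul_comm]

lemma inner_toLp_eq (f : L2R) {ψ : ℝ → ℝ} (hψ : MemLp ψ 2 (volume : Measure ℝ)) :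
    inner ℝ f (hψ.toLp ψ) = ∫ x, f x * ψ x := by
  rw [inner_L2_eq]
  refine integral_congr_ae ?_
  filter_upwards [hψ.coeFn_toLp] with x hx
  rw [hx]

/-- Each test function imposes a closed linear condition. The resulting completeness is needed for
the adjoint defining the resolvent and for integrating `H¹`-valued curves. -/
lemma isClosed_H1 : IsClosed (H1 : Set (WithLp 2 (L2R × L2R))) := by
  have : (H1 : Set (WithLp 2 (L2R × L2R))) = ⋂ (φ : ℝ → ℝ) (hφ : IsTest φ),
      {w | inner ℝ (WithLp.fstL 2 ℝ L2R L2R w) (hφ.deriv.memLp.toLp _)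
        = - inner ℝ (WithLp.sndL 2 ℝ L2R L2R w) (hφ.memLp.toLp _)} := by
    ext w
    simp only [Set.mem_iInter, Set.mem_ofPred_eq, inner_toLp_eq]
    rfl
  rw [this]
  refine isClosed_iInter fun φ => isClosed_iInter fun hφ => isClosed_eq ?_ ?_ <;> fun_prop

instance : CompleteSpace H1 := isClosed_H1.completeSpace_coe

/-- The inclusion of `H¹` in `L²`. -/
noncomputable def inclL2 : H1 →L[ℝ] L2R := WithLp.fstL 2 ℝ L2R L2R ∘L H1.subtypeL

/-- The weak derivative as a bounded map from `H¹` to `L²`. -/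
noncomputable def dxL2 : H1 →L[ℝ] L2R := WithLp.sndL 2 ℝ L2R L2R ∘L H1.subtypeL

lemma coeFn_inclL2 (w : H1) : ⇑(inclL2 w) = fn w := rfl

lemma coeFn_dxL2 (w : H1) : ⇑(dxL2 w) = dx w := rfl

lemma inner_H1_eq (v w : H1) :
    inner ℝ v w = inner ℝ (inclL2 v) (inclL2 w) + inner ℝ (dxL2 v) (dxL2 w) := by
  rw [Submodule.coe_inner, WithLp.prod_inner_apply]
  rfl

lemma isWeight_one : IsWeight (fun _ => 1) (fun _ => 0) 1 :=
  ⟨fun x => hasDerivAt_const x 1, continuous_const, by simp, by simp⟩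

/-- The element of `H¹` with given components. -/
noncomputable def mkH1 (f g : L2R)
    (h : ∀ φ : ℝ → ℝ, IsTest φ → ∫ x, f x * deriv φ x = - ∫ x, g x * φ x) : H1 :=
  ⟨WithLp.toLp 2 (f, g), h⟩

lemma IsTest.hasDerivAt {φ : ℝ → ℝ} (hφ : IsTest φ) (x : ℝ) : HasDerivAt φ (_root_.deriv φ x) x :=
  (hφ.smooth.differentiable (by simp) x).hasDerivAt

/-- A test function as an element of `H¹`. -/
noncomputable def IsTest.toH1 {φ : ℝ → ℝ} (hφ : IsTest φ) : H1 :=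
  mkH1 (hφ.memLp.toLp φ) (hφ.deriv.memLp.toLp _) fun ψ hψ => by
    have e1 : ∫ x, hφ.memLp.toLp φ x * _root_.deriv ψ x = ∫ x, φ x * _root_.deriv ψ x := by
      refine integral_congr_ae ?_
      filter_upwards [hφ.memLp.coeFn_toLp] with x hx
      rw [hx]
    have e2 : ∫ x, hφ.deriv.memLp.toLp _ x * ψ x = ∫ x, _root_.deriv φ x * ψ x := by
      refine integral_congr_ae ?_
      filter_upwards [hφ.deriv.memLp.coeFn_toLp] with x hx
      rw [hx]
    rw [e1, e2]
    exact integral_mul_deriv_eq_deriv_mul_of_integrable (fun x _ => hφ.hasDerivAt x)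
      (fun x _ => hψ.hasDerivAt x) (hφ.memLp.integrable_mul hψ.deriv.memLp)
      (hφ.deriv.memLp.integrable_mul hψ.memLp) (hφ.memLp.integrable_mul hψ.memLp)

lemma IsTest.inclL2_toH1 {φ : ℝ → ℝ} (hφ : IsTest φ) : inclL2 hφ.toH1 = hφ.memLp.toLp φ := rfl

lemma IsTest.dxL2_toH1 {φ : ℝ → ℝ} (hφ : IsTest φ) :
    dxL2 hφ.toH1 = hφ.deriv.memLp.toLp (_root_.deriv φ) := rfl

lemma inner_toH1 (v : H1) {φ : ℝ → ℝ} (hφ : IsTest φ) :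
    inner ℝ v hφ.toH1 = (∫ x, fn v x * φ x) + ∫ x, dx v x * deriv φ x := by
  rw [inner_H1_eq, hφ.inclL2_toH1, hφ.dxL2_toH1, inner_toLp_eq, inner_toLp_eq]
  rfl

lemma integral_fn_mul_add_dx_mul (v : H1) {φ : ℝ → ℝ} (hφ : IsTest φ) :
    ∫ x, (fn v x * φ x + dx v x * deriv φ x) = inner ℝ v hφ.toH1 := by
  rw [inner_toH1]
  exact integral_add (hφ.integrable_mul _) (hφ.deriv.integrable_mul _)

/-- Test functions are dense in `H¹`: an element orthogonal to all of them vanishes. -/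
theorem eq_zero_of_inner_toH1_eq_zero {v : H1}
    (h : ∀ (φ : ℝ → ℝ) (hφ : IsTest φ), inner ℝ v hφ.toH1 = 0) : v = 0 := by
  -- Orthogonality says that `v_x` has weak derivative `v`. So `v_x` lies in `H¹`, and the vanishing
  -- integral of `(v v_x)' = v_x² + v²` is the norm of `v` squared.
  let V : H1 := mkH1 (dxL2 v) (inclL2 v) fun φ hφ => by
    have := h φ hφ
    rw [inner_toH1] at this
    simp only [coeFn_inclL2, coeFn_dxL2]
    linarith
  have h1 := integral_weight_mul_mul isWeight_one v V
  have h2 : ‖v‖ ^ 2 = 0 := by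
    rw [norm_sq_eq, ← h1]
    congr 1; ext x
    have e1 : fn V = dx v := rfl
    have e2 : dx V = fn v := rfl
    rw [e1, e2]; ring
  simpa using h2

/-- The resolvent `(1 - ∂ₓ²)⁻¹ : L² → H¹`. -/
noncomputable def resolvent : L2R →L[ℝ] H1 := ContinuousLinearMap.adjoint inclL2

/-- The weak form of `f - f_xx = w`: the Riesz representation of `⟨w, ·⟩` in the `H¹` inner product.
-/
lemma inner_resolvent (w : L2R) (v : H1) : inner ℝ (resolvent w) v = inner ℝ w (inclL2 v) :=
  ContinuousLinearMap.adjoint_inner_left _ _ _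

/-- The derivative of the resolvent, `∂ₓ (1 - ∂ₓ²)⁻¹ w`, as an element of `H¹`. -/
noncomputable def resolventDx (w : L2R) : H1 :=
  mkH1 (dxL2 (resolvent w)) (inclL2 (resolvent w) - w) fun φ hφ => by
    -- The weak form tested on `φ` says precisely that `f_x` has weak derivative `f - w`.
    have h1 := inner_resolvent w hφ.toH1
    rw [inner_H1_eq, hφ.inclL2_toH1, hφ.dxL2_toH1] at h1
    rw [← inner_toLp_eq _ hφ.deriv.memLp, ← inner_toLp_eq _ hφ.memLp, inner_sub_left]
    linarith

lemma fn_resolventDx (w : L2R) : fn (resolventDx w) = dx (resolvent w) := rfl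

lemma dxL2_resolventDx (w : L2R) : dxL2 (resolventDx w) = inclL2 (resolvent w) - w := rfl

lemma dx_resolventDx (w : L2R) :
    dx (resolventDx w) =ᵐ[volume] fun x => fn (resolvent w) x - w x := by
  rw [← coeFn_dxL2, dxL2_resolventDx]
  exact Lp.coeFn_sub _ _

lemma continuous_resolventDx : Continuous resolventDx := by
  refine Continuous.subtype_mk ((WithLp.prod_continuous_toLp 2 L2R L2R).comp ?_) _
  exact (dxL2.continuous.comp resolvent.continuous).prodMk
    ((inclL2.continuous.comp resolvent.continuous).sub continuous_id)

lemma fn_add (v w : H1) : fn (v + w) =ᵐ[volume] fun x => fn v x + fn w x := by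
  rw [← coeFn_inclL2, map_add]
  exact Lp.coeFn_add _ _

lemma fn_sub (v w : H1) : fn (v - w) =ᵐ[volume] fun x => fn v x - fn w x := by
  rw [← coeFn_inclL2, map_sub]
  exact Lp.coeFn_sub _ _

lemma norm_inclL2_le (v : H1) : ‖inclL2 v‖ ≤ ‖v‖ := by
  have h := real_inner_self_eq_norm_sq v
  rw [inner_H1_eq, real_inner_self_eq_norm_sq, real_inner_self_eq_norm_sq] at h
  exact abs_le_of_sq_le_sq' (by nlinarith [sq_nonneg ‖dxL2 v‖]) (norm_nonneg _) |>.2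

/-! ### The equation as an ordinary differential equation in `H¹` -/

/-- The power `v ^ (n + 1)` of `v ∈ H¹` as an element of `L²`. -/
noncomputable def powL2 (n : ℕ) (v : H1) : L2R := (memLp_fn_pow v n).toLp _

lemma coeFn_powL2 (n : ℕ) (v : H1) : powL2 n v =ᵐ[volume] fun x => fn v x ^ (n + 1) :=
  (memLp_fn_pow v n).coeFn_toLp

/-- A local Lipschitz bound, used to make the right-hand side continuous in time along a solution.
-/
lemma norm_powL2_sub_le (n : ℕ) (v w : H1) :
    ‖powL2 n v - powL2 n w‖ ≤ ((n + 1 : ℕ) * max ‖v‖ ‖w‖ ^ n) * ‖v - w‖ := by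
  refine le_trans ?_ (mul_le_mul_of_nonneg_left (norm_inclL2_le (v - w)) (by positivity))
  refine Lp.norm_le_mul_norm_of_ae_le_mul ?_
  filter_upwards [Lp.coeFn_sub (powL2 n v) (powL2 n w), coeFn_powL2 n v, coeFn_powL2 n w,
    fn_sub v w, ae_abs_fn_le v, ae_abs_fn_le w] with x h1 h2 h3 h4 h5 h6
  rw [coeFn_inclL2, h4, h1, Pi.sub_apply, h2, h3]
  simp only [Real.norm_eq_abs]
  refine (abs_pow_sub_pow_le _ _ _).trans ?_
  rw [Nat.add_sub_cancel, mul_assoc, mul_comm]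
  gcongr

lemma continuous_powL2 (n : ℕ) : Continuous (powL2 n) := by
  refine continuous_iff_continuousAt.2 fun v => ?_
  rw [ContinuousAt, tendsto_iff_norm_sub_tendsto_zero]
  refine squeeze_zero (fun _ => norm_nonneg _) (fun w => norm_powL2_sub_le n w v) ?_
  have : Continuous fun w : H1 => ((n + 1 : ℕ) * max ‖w‖ ‖v‖ ^ n) * ‖w - v‖ := by fun_prop
  simpa using this.tendsto v

/-- The nonlinearity `u + u ^ (n + 2)` as a map from `H¹` to `L²`. -/
noncomputable def nonlinearity (n : ℕ) (v : H1) : L2R := inclL2 v + powL2 (n + 1) v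

lemma coeFn_nonlinearity (n : ℕ) (v : H1) :
    nonlinearity n v =ᵐ[volume] fun x => fn v x + fn v x ^ (n + 2) := by
  filter_upwards [Lp.coeFn_add (inclL2 v) (powL2 (n + 1) v), coeFn_powL2 (n + 1) v] with x h1 h2
  rw [nonlinearity, h1, Pi.add_apply, h2]
  rfl

lemma continuous_nonlinearity (n : ℕ) : Continuous (nonlinearity n) :=
  inclL2.continuous.add (continuous_powL2 _)

lemma inner_resolventDx (w : L2R) {φ : ℝ → ℝ} (hφ : IsTest φ) :
    inner ℝ (resolventDx w) hφ.toH1 = - ∫ x, w x * deriv φ x := by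
  have h := integral_fn_mul_deriv (resolvent w) hφ
  rw [← inner_toLp_eq _ hφ.deriv.memLp, inner_H1_eq, dxL2_resolventDx, inner_sub_left,
    hφ.dxL2_toH1, hφ.inclL2_toH1, inner_toLp_eq, inner_toLp_eq, coeFn_inclL2, coeFn_inclL2,
    fn_resolventDx]
  linarith

/-- A global solution solves `u_t = -∂ₓ (1 - ∂ₓ²)⁻¹ (u + u ^ p)` in `H¹`. -/
theorem IsGlobalSolution.hasDerivAt {n : ℕ} {u₀ : H1} {u : ℝ → H1}
    (hu : IsGlobalSolution (n + 2) u₀ u) (t : ℝ) :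
    HasDerivAt u (-resolventDx (nonlinearity n (u t))) t := by
  set G : ℝ → H1 := fun t => -resolventDx (nonlinearity n (u t)) with hG
  have hGc : Continuous G :=
    (continuous_resolventDx.comp ((continuous_nonlinearity n).comp hu.continuous)).neg
  -- The equation holds only against test functions. The candidate `k` is strongly differentiable
  -- with derivative `G`; `u - k` tested on any `φ` is constant in time and starts at `0`, so
  -- density gives `u = k`.
  let k : ℝ → H1 := fun t => u 0 + ∫ s in (0 : ℝ)..t, G s
  have hk : ∀ t, HasDerivAt k (G t) t := fun t =>
    (hGc.integral_hasStrictDerivAt 0 t).hasDerivAt.const_add _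
  have huk : u = k := by
    funext s
    rw [← sub_eq_zero]
    refine eq_zero_of_inner_toH1_eq_zero fun φ hφ => ?_
    have hd : ∀ t, HasDerivAt (fun s => inner ℝ (u s - k s) hφ.toH1) 0 t := by
      intro t
      have h1 := hu.equation φ hφ t
      simp_rw [integral_fn_mul_add_dx_mul _ hφ] at h1
      have h2 := (hk t).inner ℝ (hasDerivAt_const t hφ.toH1)
      have h3 := h1.sub h2
      have e : ∫ x, (fn (u t) x + fn (u t) x ^ (n + 2)) * deriv φ x
          = ∫ x, nonlinearity n (u t) x * deriv φ x := by
        refine integral_congr_ae ?_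
        filter_upwards [coeFn_nonlinearity n (u t)] with x hx
        rw [hx]
      have h0 : (∫ x, nonlinearity n (u t) x * deriv φ x)
          - (inner ℝ (k t) (0 : H1) + inner ℝ (G t) hφ.toH1) = 0 := by
        rw [hG, inner_neg_left, inner_resolventDx, inner_zero_right]
        ring
      rw [e, h0] at h3
      refine h3.congr_of_eventuallyEq (.of_forall fun s => ?_)
      exact inner_sub_left _ _ _
    have := is_const_of_deriv_eq_zero (fun t => (hd t).differentiableAt) (fun t => (hd t).deriv) s 0
    rw [this]
    simp [k]
  have := hk t
  rwa [← huk] at this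

/-! ### Differentiating weighted energies in time -/

/-- Multiplication of an `L²` function by an `L^∞` function, as a bounded bilinear map. -/
noncomputable def mulLinfty : Lp ℝ ∞ (volume : Measure ℝ) →L[ℝ] L2R →L[ℝ] L2R :=
  (ContinuousLinearMap.mul ℝ ℝ).holderL volume ∞ 2 2

lemma coeFn_mulLinfty (m : Lp ℝ ∞ (volume : Measure ℝ)) (f : L2R) :
    mulLinfty m f =ᵐ[volume] fun x => m x * f x :=
  (ContinuousLinearMap.mul ℝ ℝ).coeFn_holder (r := 2) m f

lemma memLp_top_of_abs_le {m : ℝ → ℝ} {K : ℝ} (hm : Continuous m) (hK : ∀ x, |m x| ≤ K) :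
    MemLp m ∞ (volume : Measure ℝ) :=
  memLp_top_of_bound hm.aestronglyMeasurable K (ae_of_all _ hK)

lemma inner_mulLinfty_toLp {m : ℝ → ℝ} (hm : MemLp m ∞ (volume : Measure ℝ)) (f g : L2R) :
    inner ℝ (mulLinfty (hm.toLp m) f) g = ∫ x, m x * (f x * g x) := by
  rw [inner_L2_eq]
  refine integral_congr_ae ?_
  filter_upwards [coeFn_mulLinfty (hm.toLp m) f, hm.coeFn_toLp] with x h1 h2
  rw [h1, h2, mul_assoc]

lemma norm_toLp_top_le {m : ℝ → ℝ} {K : ℝ} (hK0 : 0 ≤ K) (hm : MemLp m ∞ (volume : Measure ℝ))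
    (hK : ∀ x, |m x| ≤ K) : ‖hm.toLp m‖ ≤ K := by
  rw [Lp.norm_toLp, eLpNorm_exponent_top]
  exact ENNReal.toReal_le_of_le_ofReal hK0 (eLpNormEssSup_le_of_ae_bound (ae_of_all _ hK))

theorem hasDerivAt_integral_weight_mul_self {f : ℝ → L2R} {f' : L2R} {t K : ℝ}
    (hf : HasDerivAt f f' t) {Ψ : ℝ → ℝ → ℝ} {Ψ' : ℝ → ℝ} (hΨ : ∀ s, Continuous (Ψ s))
    (hΨ' : Continuous Ψ') (hK : ∀ s x, |Ψ s x| ≤ K) (hK' : ∀ x, |Ψ' x| ≤ K)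
    (hT : ∀ s x, |Ψ s x - Ψ t x - (s - t) * Ψ' x| ≤ K * (s - t) ^ 2) :
    HasDerivAt (fun s => ∫ x, Ψ s x * (f s x * f s x))
      ((∫ x, Ψ' x * (f t x * f t x)) + 2 * ∫ x, Ψ t x * (f t x * f' x)) t := by
  have m1 : ∀ s, MemLp (Ψ s) ∞ (volume : Measure ℝ) := fun s => memLp_top_of_abs_le (hΨ s) (hK s)
  have m2 : MemLp Ψ' ∞ (volume : Measure ℝ) := memLp_top_of_abs_le hΨ' hK'
  have hK0 : 0 ≤ K := (abs_nonneg _).trans (hK' 0)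
  -- The uniform quadratic remainder makes the weight a differentiable curve in `L^∞`; the claim is
  -- then the product rule for bounded bilinear maps.
  have hW : HasDerivAt (fun s => (m1 s).toLp (Ψ s)) (m2.toLp Ψ') t := by
    rw [hasDerivAt_iff_isLittleO]
    have hb : ∀ s, ‖(m1 s).toLp (Ψ s) - (m1 t).toLp (Ψ t) - (s - t) • m2.toLp Ψ'‖
        ≤ K * (s - t) ^ 2 := by
      intro s
      rw [← MemLp.toLp_sub, ← MemLp.toLp_const_smul, ← MemLp.toLp_sub]
      exact norm_toLp_top_le (by positivity) _ fun x => hT s x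
    refine Asymptotics.IsBigO.trans_isLittleO (g := fun s => (s - t) ^ 2)
      (Asymptotics.IsBigO.of_bound K (.of_forall fun s => ?_)) ?_
    · rw [Real.norm_of_nonneg (sq_nonneg (s - t))]
      exact hb s
    · simpa using Asymptotics.isLittleO_pow_sub_sub t one_lt_two
  have h1 := (((mulLinfty.hasFDerivAt.comp_hasDerivAt t hW).clm_apply hf).inner ℝ hf)
  simp only [Function.comp_apply, inner_add_left, inner_mulLinfty_toLp] at h1
  convert! h1 using 1
  have e : ∫ x, Ψ t x * (f' x * f t x) = ∫ x, Ψ t x * (f t x * f' x) := by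
    congr 1; ext x; ring
  rw [e]
  ring

lemma IsWeight.comp_add_const {ρ ρ' : ℝ → ℝ} {K : ℝ} (h : IsWeight ρ ρ' K) (c : ℝ) :
    IsWeight (fun x => ρ (x + c)) (fun x => ρ' (x + c)) K where
  hasDerivAt x := (h.hasDerivAt (x + c)).comp_add_const x c
  continuous_deriv := h.continuous_deriv.comp (continuous_add_const c)
  abs_le _ := h.abs_le _
  abs_deriv_le _ := h.abs_deriv_le _

lemma IsWeight.abs_sub_le {ρ ρ' : ℝ → ℝ} {K : ℝ} (h : IsWeight ρ ρ' K) (x y : ℝ) :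
    |ρ y - ρ x| ≤ K * |y - x| := by
  have := Convex.norm_image_sub_le_of_norm_hasDerivWithin_le (f := ρ) (f' := ρ') (s := Set.univ)
    (C := K) (fun z _ => (h.hasDerivAt z).hasDerivWithinAt) (fun z _ => h.abs_deriv_le z)
    convex_univ (Set.mem_univ x) (Set.mem_univ y)
  simpa using this

/-- The mean value inequality for `z ↦ ψ z - z ρ(x)`, whose derivative is at most `K|y - x|` between
`x` and `y`. It provides the uniform remainder for moving weights. -/
lemma IsWeight.abs_taylor_le {ψ ρ ρ' : ℝ → ℝ} {K : ℝ} (hψ : IsWeight ψ ρ K) (hρ : IsWeight ρ ρ' K)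
    (x y : ℝ) : |ψ y - ψ x - (y - x) * ρ x| ≤ K * (y - x) ^ 2 := by
  have h := Convex.norm_image_sub_le_of_norm_hasDerivWithin_le (f := fun z => ψ z - z * ρ x)
    (f' := fun z => ρ z - 1 * ρ x) (s := Set.uIcc x y) (C := K * |y - x|)
    (fun z _ => ((hψ.hasDerivAt z).sub ((hasDerivAt_id z).mul_const _)).hasDerivWithinAt)
    (fun z hz => ?_) (convex_uIcc _ _) Set.left_mem_uIcc Set.right_mem_uIcc
  · rw [Real.norm_eq_abs, Real.norm_eq_abs, mul_assoc, ← sq, sq_abs] at h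
    convert! h using 2
    ring
  · rw [one_mul, Real.norm_eq_abs]
    refine (hρ.abs_sub_le x z).trans ?_
    have hK0 : 0 ≤ K := (abs_nonneg _).trans (hψ.abs_le 0)
    exact mul_le_mul_of_nonneg_left (Set.abs_sub_left_of_mem_uIcc hz) hK0

/-- The derivative in time of the energy `∫ ψ(x + σ t + c) (u² + u_x²)` of a curve in `H¹`. -/
lemma hasDerivAt_weighted_energy {u : ℝ → H1} {u' : H1} {t K : ℝ} (hu : HasDerivAt u u' t)
    {ψ ρ ρ' : ℝ → ℝ} (hψ : IsWeight ψ ρ K) (hρ : IsWeight ρ ρ' K) (σ c : ℝ) :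
    HasDerivAt (fun s => ∫ x, ψ (x + (σ * s + c)) * (fn (u s) x ^ 2 + dx (u s) x ^ 2))
      (∫ x, (ρ (x + (σ * t + c)) * (σ * (fn (u t) x ^ 2 + dx (u t) x ^ 2))
        + 2 * (ψ (x + (σ * t + c)) * (fn (u t) x * fn u' x + dx (u t) x * dx u' x)))) t := by
  have hK0 : 0 ≤ K := (abs_nonneg _).trans (hψ.abs_le 0)
  have hψs : ∀ s, Continuous fun x => ψ (x + (σ * s + c)) := fun s =>
    (hψ.comp_add_const _).continuous
  have hρs : Continuous fun x => ρ (x + (σ * t + c)) := (hρ.comp_add_const _).continuous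
  -- One constant for the weight, its time derivative (factor `|σ|`) and its quadratic remainder
  -- (factor `σ²`).
  set K' := K * (1 + |σ| + σ ^ 2)
  have hKK' : K ≤ K' := le_mul_of_one_le_right hK0 (by nlinarith [abs_nonneg σ, sq_nonneg σ])
  have B1 : ∀ x, |σ * ρ (x + (σ * t + c))| ≤ K' := fun x => by
    rw [abs_mul]
    calc |σ| * |ρ (x + (σ * t + c))| ≤ |σ| * K := by gcongr; exact hρ.abs_le _
      _ ≤ K' := by rw [mul_comm]; exact mul_le_mul_of_nonneg_left (by nlinarith [sq_nonneg σ]) hK0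
  have B2 : ∀ s x, |ψ (x + (σ * s + c)) - ψ (x + (σ * t + c))
      - (s - t) * (σ * ρ (x + (σ * t + c)))| ≤ K' * (s - t) ^ 2 := fun s x => by
    have h := hψ.abs_taylor_le hρ (x + (σ * t + c)) (x + (σ * s + c))
    have e1 : x + (σ * s + c) - (x + (σ * t + c)) = σ * (s - t) := by ring
    rw [e1] at h
    have e2 : (s - t) * (σ * ρ (x + (σ * t + c))) = σ * (s - t) * ρ (x + (σ * t + c)) := by ring
    rw [e2]
    refine h.trans ?_
    rw [mul_pow, ← mul_assoc]
    exact mul_le_mul_of_nonneg_right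
      (mul_le_mul_of_nonneg_left (by nlinarith [abs_nonneg σ]) hK0) (sq_nonneg _)
  have hd : ∀ A : H1 →L[ℝ] L2R, _ := fun A =>
    hasDerivAt_integral_weight_mul_self (A.hasFDerivAt.comp_hasDerivAt t hu)
      (Ψ := fun s x => ψ (x + (σ * s + c))) (Ψ' := fun x => σ * ρ (x + (σ * t + c))) (K := K')
      hψs (hρs.const_smul σ) (fun s x => (hψ.abs_le _).trans hKK') B1 B2
  have h := (hd inclL2).add (hd dxL2)
  simp only [Function.comp_apply, coeFn_inclL2, coeFn_dxL2] at h
  have iψ : ∀ s {f g : ℝ → ℝ}, MemLp f 2 → MemLp g 2 →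
      Integrable fun x => ψ (x + (σ * s + c)) * (f x * g x) := fun s f g hf hg =>
    integrable_mul_mul (hψs s) (fun x => hψ.abs_le _) hf hg
  have iρ : ∀ {f g : ℝ → ℝ}, MemLp f 2 → MemLp g 2 →
      Integrable fun x => σ * ρ (x + (σ * t + c)) * (f x * g x) := fun hf hg =>
    integrable_mul_mul (hρs.const_smul σ) B1 hf hg
  have h0 := memLp_fn (u t)
  have h1 := memLp_dx (u t)
  have h0' := memLp_fn u'
  have h1' := memLp_dx u'
  have e : (∫ x, (ρ (x + (σ * t + c)) * (σ * (fn (u t) x ^ 2 + dx (u t) x ^ 2))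
        + 2 * (ψ (x + (σ * t + c)) * (fn (u t) x * fn u' x + dx (u t) x * dx u' x))))
      = ((∫ x, σ * ρ (x + (σ * t + c)) * (fn (u t) x * fn (u t) x))
        + 2 * ∫ x, ψ (x + (σ * t + c)) * (fn (u t) x * fn u' x))
      + ((∫ x, σ * ρ (x + (σ * t + c)) * (dx (u t) x * dx (u t) x))
        + 2 * ∫ x, ψ (x + (σ * t + c)) * (dx (u t) x * dx u' x)) := by
    rw [← integral_const_mul, ← integral_const_mul,
      ← integral_add (iρ h0 h0) ((iψ t h0 h0').const_mul 2),
      ← integral_add (iρ h1 h1) ((iψ t h1 h1').const_mul 2),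
      ← integral_add ((iρ h0 h0).fun_add ((iψ t h0 h0').const_mul 2))
        ((iρ h1 h1).fun_add ((iψ t h1 h1').const_mul 2))]
    congr 1; ext x; ring
  rw [e]
  refine h.congr_of_eventuallyEq (.of_forall fun s => ?_)
  simp only [Pi.add_apply]
  rw [← integral_add (iψ s (memLp_fn _) (memLp_fn _)) (iψ s (memLp_dx _) (memLp_dx _))]
  congr 1; ext x; ring

/-- The virial identity for the energy density along a solution. -/
theorem IsGlobalSolution.hasDerivAt_virial {n : ℕ} {u₀ : H1} {u : ℝ → H1}
    (hu : IsGlobalSolution (n + 2) u₀ u) {ψ ρ ρ' : ℝ → ℝ} {K : ℝ} (hψ : IsWeight ψ ρ K)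
    (hρ : IsWeight ρ ρ' K) (σ c t : ℝ) :
    HasDerivAt (fun s => ∫ x, ψ (x + (σ * s + c)) * (fn (u s) x ^ 2 + dx (u s) x ^ 2))
      (∫ x, ρ (x + (σ * t + c)) * (σ * (fn (u t) x ^ 2 + dx (u t) x ^ 2)
        + 2 * (fn (u t) x * fn (resolvent (nonlinearity n (u t))) x)
        - fn (u t) x ^ 2 - 2 / (n + 3) * fn (u t) x ^ (n + 3))) t := by
  convert! hasDerivAt_weighted_energy (hu.hasDerivAt t) hψ hρ σ c using 1
  set W := nonlinearity n (u t) with hW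
  set F := resolvent W with hF
  set G := -resolventDx W with hG
  have hψt := hψ.comp_add_const (σ * t + c)
  have hρt := hρ.comp_add_const (σ * t + c)
  set ψ₁ : ℝ → ℝ := fun x => ψ (x + (σ * t + c))
  set ρ₁ : ℝ → ℝ := fun x => ρ (x + (σ * t + c))
  change ∫ x, ρ₁ x * _ = ∫ x, (ρ₁ x * _ + 2 * (ψ₁ x * _))
  have hGf : fn G =ᵐ[volume] fun x => - dx F x := by
    rw [hG, ← coeFn_inclL2, map_neg]
    exact Lp.coeFn_neg _
  have hGd : dx G =ᵐ[volume] fun x => W x - fn F x := by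
    have h1 : dx G =ᵐ[volume] fun x => - dx (resolventDx W) x := by
      rw [hG, ← coeFn_dxL2, map_neg]
      exact Lp.coeFn_neg _
    filter_upwards [h1, dx_resolventDx W] with x h1 h2
    rw [h1, h2, hF]; ring
  have h0 := memLp_fn (u t)
  have h1 := memLp_dx (u t)
  have iψ : ∀ {f g : ℝ → ℝ}, MemLp f 2 → MemLp g 2 → Integrable fun x => ψ₁ x * (f x * g x) :=
    fun hf hg => integrable_mul_mul hψt.continuous hψt.abs_le hf hg
  have iρ : ∀ {f g : ℝ → ℝ}, MemLp f 2 → MemLp g 2 → Integrable fun x => ρ₁ x * (f x * g x) :=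
    fun hf hg => integrable_mul_mul hρt.continuous hρt.abs_le hf hg
  have hp := memLp_fn_pow (u t) (n + 1)
  -- With `G = -F_x` and `G_x = W - F`, the integrand `2(uG + u_x G_x)` is `-2(uF)_x + (u²)_x +
  -- 2/(p+1) (u^(p+1))_x`; these identities move the three derivatives onto the weight.
  have z1 := integral_weight_mul_mul hψt (u t) F
  have z2 := integral_weight_mul_pow hψt (u t) 0
  have z3 := integral_weight_mul_pow hψt (u t) (n + 1)
  have i1 : Integrable fun x => ρ₁ x * (fn (u t) x * fn F x)
      + ψ₁ x * (dx (u t) x * fn F x + fn (u t) x * dx F x) := by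
    refine ((iρ h0 (memLp_fn F)).add ((iψ h1 (memLp_fn F)).add (iψ h0 (memLp_dx F)))).congr
      (ae_of_all _ fun x => ?_)
    simp only [Pi.add_apply]; ring
  have i2 : Integrable fun x => ρ₁ x * fn (u t) x ^ (0 + 2)
      + ψ₁ x * (((0 : ℕ) + 2) * fn (u t) x ^ (0 + 1) * dx (u t) x) := by
    refine ((iρ h0 h0).add ((iψ h0 h1).const_mul 2)).congr (ae_of_all _ fun x => ?_)
    simp only [Pi.add_apply]; push_cast; ring
  have i3 : Integrable fun x => ρ₁ x * fn (u t) x ^ (n + 1 + 2)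
      + ψ₁ x * (((n + 1 : ℕ) + 2) * fn (u t) x ^ (n + 1 + 1) * dx (u t) x) := by
    refine ((iρ hp h0).add ((iψ hp h1).const_mul ((n + 1 : ℕ) + 2))).congr
      (ae_of_all _ fun x => ?_)
    simp only [Pi.add_apply]; push_cast; ring
  have i0 : Integrable fun x => ρ₁ x * (σ * (fn (u t) x ^ 2 + dx (u t) x ^ 2))
      + 2 * (ψ₁ x * (fn (u t) x * fn G x + dx (u t) x * dx G x)) := by
    refine ((((iρ h0 h0).add (iρ h1 h1)).const_mul σ).add (((iψ h0 (memLp_fn G)).add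
      (iψ h1 (memLp_dx G))).const_mul 2)).congr (ae_of_all _ fun x => ?_)
    simp only [Pi.add_apply]; ring
  have key : ∫ x, ρ₁ x * (σ * (fn (u t) x ^ 2 + dx (u t) x ^ 2)
        + 2 * (fn (u t) x * fn F x) - fn (u t) x ^ 2 - 2 / (n + 3) * fn (u t) x ^ (n + 3))
      = ∫ x, ((ρ₁ x * (σ * (fn (u t) x ^ 2 + dx (u t) x ^ 2))
          + 2 * (ψ₁ x * (fn (u t) x * fn G x + dx (u t) x * dx G x)))
        + 2 * (ρ₁ x * (fn (u t) x * fn F x)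
          + ψ₁ x * (dx (u t) x * fn F x + fn (u t) x * dx F x))
        - (ρ₁ x * fn (u t) x ^ (0 + 2)
          + ψ₁ x * (((0 : ℕ) + 2) * fn (u t) x ^ (0 + 1) * dx (u t) x))
        - 2 / (n + 3) * (ρ₁ x * fn (u t) x ^ (n + 1 + 2)
          + ψ₁ x * (((n + 1 : ℕ) + 2) * fn (u t) x ^ (n + 1 + 1) * dx (u t) x))) := by
    refine integral_congr_ae ?_
    filter_upwards [hGf, hGd, coeFn_nonlinearity n (u t)] with x h1 h2 h3
    rw [h1, h2, hW, h3]
    have : (n + 3 : ℝ) ≠ 0 := by positivity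
    push_cast
    field_simp
    ring
  rw [key, integral_sub ?_ (i3.const_mul _), integral_sub (i0.fun_add (i1.const_mul 2)) i2,
    integral_add i0 (i1.const_mul 2), integral_const_mul, integral_const_mul, z1, z2, z3]
  · ring
  · exact (i0.fun_add (i1.const_mul 2)).sub i2

/-- Conservation of the `H¹` norm. -/
theorem IsGlobalSolution.norm_eq {n : ℕ} {u₀ : H1} {u : ℝ → H1}
    (hu : IsGlobalSolution (n + 2) u₀ u) (t : ℝ) : ‖u t‖ = ‖u₀‖ := by
  have hw : IsWeight (fun _ => 0) (fun _ => 0) 1 :=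
    ⟨fun x => hasDerivAt_const x 0, continuous_const, by simp, by simp⟩
  have hd := fun s => hu.hasDerivAt_virial isWeight_one hw 0 0 s
  simp only [one_mul, zero_mul, integral_zero, ← norm_sq_eq] at hd
  have := is_const_of_deriv_eq_zero (fun t => (hd t).differentiableAt) (fun t => (hd t).deriv) t 0
  rw [hu.initial] at this
  exact (sq_eq_sq₀ (norm_nonneg _) (norm_nonneg _)).1 this

/-! ### Coercivity of the virial form -/

/-- A nonnegative weight whose logarithmic derivative is bounded by `δ`. -/
structure IsSlowWeight (ρ ρ' : ℝ → ℝ) (K δ : ℝ) : Prop extends IsWeight ρ ρ' K where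
  nonneg : ∀ x, 0 ≤ ρ x
  abs_deriv_le_mul : ∀ x, |ρ' x| ≤ δ * ρ x

lemma IsSlowWeight.comp_add_const {ρ ρ' : ℝ → ℝ} {K δ : ℝ} (h : IsSlowWeight ρ ρ' K δ) (c : ℝ) :
    IsSlowWeight (fun x => ρ (x + c)) (fun x => ρ' (x + c)) K δ where
  toIsWeight := h.toIsWeight.comp_add_const c
  nonneg _ := h.nonneg _
  abs_deriv_le_mul _ := h.abs_deriv_le_mul _

lemma IsWeight.integrable_mul {ρ ρ' f g : ℝ → ℝ} {K : ℝ} (h : IsWeight ρ ρ' K)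
    (hf : MemLp f 2) (hg : MemLp g 2) : Integrable fun x => ρ x * (f x * g x) :=
  integrable_mul_mul h.continuous h.abs_le hf hg

lemma IsWeight.integrable_sq {ρ ρ' f : ℝ → ℝ} {K : ℝ} (h : IsWeight ρ ρ' K)
    (hf : MemLp f 2) : Integrable fun x => ρ x * f x ^ 2 := by
  simpa only [sq] using h.integrable_mul hf hf

lemma IsWeight.integrable_energy {ρ ρ' : ℝ → ℝ} {K : ℝ} (h : IsWeight ρ ρ' K) (u : H1) :
    Integrable fun x => ρ x * (fn u x ^ 2 + dx u x ^ 2) := by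
  simpa only [mul_add] using (h.integrable_sq (memLp_fn u)).fun_add (h.integrable_sq (memLp_dx u))

lemma IsWeight.integrable_weight_mul_mul {ρ ρ' : ℝ → ℝ} {K : ℝ} (hρ : IsWeight ρ ρ' K) (v w : H1) :
    Integrable fun x =>
      ρ' x * (fn v x * fn w x) + ρ x * (dx v x * fn w x + fn v x * dx w x) := by
  simpa only [mul_add] using (integrable_mul_mul hρ.continuous_deriv hρ.abs_deriv_le (memLp_fn v)
    (memLp_fn w)).fun_add ((hρ.integrable_mul (memLp_dx v) (memLp_fn w)).fun_add
      (hρ.integrable_mul (memLp_fn v) (memLp_dx w)))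

lemma abs_two_mul_mul_le {r s : ℝ} (h : |r| ≤ s) (f g : ℝ) :
    |2 * (r * (f * g))| ≤ s * (f ^ 2 + g ^ 2) := by
  have h1 : |2 * (r * (f * g))| = |r| * |2 * (f * g)| := by
    rw [← abs_mul]; congr 1; ring
  rw [h1]
  have h2 : |2 * (f * g)| ≤ f ^ 2 + g ^ 2 := by
    rw [abs_le]; constructor <;> nlinarith [sq_nonneg (f + g), sq_nonneg (f - g)]
  exact mul_le_mul h h2 (abs_nonneg _) ((abs_nonneg _).trans h)

section

variable {ρ ρ' : ℝ → ℝ} {K δ : ℝ}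

/-- The resolvent is bounded on `L²` with a slowly varying weight. -/
lemma IsSlowWeight.integral_resolvent_sq_le (hρ : IsSlowWeight ρ ρ' K δ) (hδ : δ ≤ 1) (w : L2R) :
    (1 - δ) * ∫ x, ρ x * fn (resolvent w) x ^ 2 ≤ ∫ x, ρ x * w x ^ 2 := by
  have z := integral_weight_mul_mul hρ.toIsWeight (resolvent w) (resolventDx w)
  have iz := hρ.integrable_weight_mul_mul (resolvent w) (resolventDx w)
  have i1 := hρ.integrable_sq (Lp.memLp w)
  have i2 := hρ.integrable_sq (memLp_fn (resolvent w))
  -- Adding twice the null integral of `(ρ f f_x)'` gives `ρ((w - f)² + 2f_x² + δf²) + 2ρ' f f_x`;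
  -- slow variation bounds the last term by `δρ(f² + f_x²)`.
  have key : 0 ≤ ∫ x, (ρ x * w x ^ 2 - (1 - δ) * (ρ x * fn (resolvent w) x ^ 2)
      + 2 * (ρ' x * (fn (resolvent w) x * fn (resolventDx w) x)
        + ρ x * (dx (resolvent w) x * fn (resolventDx w) x
          + fn (resolvent w) x * dx (resolventDx w) x))) := by
    refine integral_nonneg_of_ae ?_
    filter_upwards [dx_resolventDx w] with x hx
    rw [hx, fn_resolventDx]
    have h1 := (abs_le.1 (abs_two_mul_mul_le (hρ.abs_deriv_le_mul x) (fn (resolvent w) x)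
      (dx (resolvent w) x))).1
    have h2 := mul_nonneg (hρ.nonneg x) (sq_nonneg (w x - fn (resolvent w) x))
    have h3 := mul_nonneg (mul_nonneg (hρ.nonneg x) (by linarith : 0 ≤ 2 - δ))
      (sq_nonneg (dx (resolvent w) x))
    simp only [Pi.zero_apply]
    linarith
  rw [integral_add (by exact i1.sub (i2.const_mul _)) (iz.const_mul 2),
    integral_sub i1 (i2.const_mul _), integral_const_mul, integral_const_mul, z] at key
  linarith

lemma IsSlowWeight.integral_fn_sq_le (hρ : IsSlowWeight ρ ρ' K δ) (u : H1) :
    ∫ x, ρ x * fn u x ^ 2 ≤ ∫ x, ρ x * (fn u x ^ 2 + dx u x ^ 2) :=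
  integral_mono (hρ.integrable_sq (memLp_fn u)) (hρ.integrable_energy u) fun x =>
    mul_le_mul_of_nonneg_left (by nlinarith [sq_nonneg (dx u x)]) (hρ.nonneg x)

/-- Pointwise `|u^p| ≤ η|u|`, and the weighted resolvent bound costs `1/(1 - δ) ≤ 2`. -/
lemma IsSlowWeight.integral_resolvent_pow_sq_le (hρ : IsSlowWeight ρ ρ' K δ) (hδ : δ ≤ 1 / 2)
    (n : ℕ) {u : H1} {η : ℝ} (hu : ∀ᵐ x, |fn u x| ^ (n + 1) ≤ η) :
    ∫ x, ρ x * fn (resolvent (powL2 (n + 1) u)) x ^ 2 ≤ 2 * η ^ 2 * ∫ x, ρ x * fn u x ^ 2 := by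
  have h1 := hρ.integral_resolvent_sq_le (hδ.trans (by norm_num)) (powL2 (n + 1) u)
  have h2 : ∫ x, ρ x * powL2 (n + 1) u x ^ 2 ≤ ∫ x, η ^ 2 * (ρ x * fn u x ^ 2) := by
    refine integral_mono_ae (hρ.integrable_sq (Lp.memLp _))
      ((hρ.integrable_sq (memLp_fn u)).const_mul _) ?_
    filter_upwards [coeFn_powL2 (n + 1) u, hu] with x hx hx'
    have : (fn u x ^ (n + 1 + 1)) ^ 2 ≤ η ^ 2 * fn u x ^ 2 := by
      rw [← sq_abs (fn u x ^ (n + 1 + 1)), ← sq_abs (fn u x), abs_pow, pow_succ |fn u x| (n + 1),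
        mul_pow]
      gcongr
    rw [hx]
    nlinarith [hρ.nonneg x]
  have h3 : 0 ≤ ∫ x, ρ x * fn (resolvent (powL2 (n + 1) u)) x ^ 2 :=
    integral_nonneg fun x => mul_nonneg (hρ.nonneg x) (sq_nonneg _)
  rw [integral_const_mul] at h2
  nlinarith

/-- The contribution of the nonlinearity to the virial form is small for small solutions. -/
lemma IsSlowWeight.abs_integral_nonlinear_le (hρ : IsSlowWeight ρ ρ' K δ) (hδ : δ ≤ 1 / 2)
    (n : ℕ) {u : H1} {η : ℝ} (hη : 0 < η) (hu : ∀ᵐ x, |fn u x| ^ (n + 1) ≤ η) :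
    |∫ x, ρ x * (2 * (fn u x * fn (resolvent (powL2 (n + 1) u)) x)
      - 2 / (n + 3) * fn u x ^ (n + 3))| ≤ 4 * η * ∫ x, ρ x * (fn u x ^ 2 + dx u x ^ 2) := by
  have i1 := (hρ.integrable_sq (memLp_fn u)).const_mul (2 * η)
  have i2 := (hρ.integrable_sq (memLp_fn (resolvent (powL2 (n + 1) u)))).const_mul η⁻¹
  have h1 : |∫ x, ρ x * (2 * (fn u x * fn (resolvent (powL2 (n + 1) u)) x)
      - 2 / (n + 3) * fn u x ^ (n + 3))|
      ≤ ∫ x, (2 * η * (ρ x * fn u x ^ 2)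
        + η⁻¹ * (ρ x * fn (resolvent (powL2 (n + 1) u)) x ^ 2)) := by
    rw [← Real.norm_eq_abs]
    refine norm_integral_le_of_norm_le (i1.add i2) ?_
    filter_upwards [hu] with x hx
    set a := fn u x
    set N := fn (resolvent (powL2 (n + 1) u)) x
    -- Young's inequality is balanced at `η` because `N` has size `η|u|` in weighted `L²`: each half
    -- then contributes order `η`.
    have e1 : |2 * (a * N)| ≤ η * a ^ 2 + η⁻¹ * N ^ 2 := by
      have hs : η * η⁻¹ = 1 := mul_inv_cancel₀ hη.ne'
      have q1 := mul_nonneg hη.le (sq_nonneg (a - η⁻¹ * N))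
      have q2 := mul_nonneg hη.le (sq_nonneg (a + η⁻¹ * N))
      have r1 : η * (a - η⁻¹ * N) ^ 2
          = η * a ^ 2 - 2 * (η * η⁻¹) * (a * N) + (η * η⁻¹) * (η⁻¹ * N ^ 2) := by ring
      have r2 : η * (a + η⁻¹ * N) ^ 2
          = η * a ^ 2 + 2 * (η * η⁻¹) * (a * N) + (η * η⁻¹) * (η⁻¹ * N ^ 2) := by ring
      rw [r1, hs] at q1
      rw [r2, hs] at q2
      rw [abs_le]
      constructor <;> linarith
    have e2 : |2 / (n + 3) * a ^ (n + 3)| ≤ η * a ^ 2 := by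
      have hc : |(2 : ℝ) / (n + 3)| ≤ 1 := by
        rw [abs_of_nonneg (by positivity), div_le_one (by positivity)]
        linarith [(Nat.cast_nonneg n : (0 : ℝ) ≤ n)]
      have e3 : |a ^ (n + 3)| ≤ η * a ^ 2 := by
        rw [abs_pow, show n + 3 = n + 1 + 2 by ring, pow_add, sq_abs]
        gcongr
      rw [abs_mul]
      calc |(2 : ℝ) / (n + 3)| * |a ^ (n + 3)| ≤ 1 * (η * a ^ 2) := by gcongr
        _ = _ := one_mul _
    rw [norm_mul, Real.norm_of_nonneg (hρ.nonneg x), Real.norm_eq_abs]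
    have e4 := (abs_sub (2 * (a * N)) (2 / (n + 3) * a ^ (n + 3))).trans (add_le_add e1 e2)
    have := mul_le_mul_of_nonneg_left e4 (hρ.nonneg x)
    linarith
  refine h1.trans ?_
  rw [integral_add i1 i2, integral_const_mul, integral_const_mul]
  have h2 := mul_le_mul_of_nonneg_left (hρ.integral_resolvent_pow_sq_le hδ n hu)
    (inv_nonneg.2 hη.le)
  have h3 : η⁻¹ * (2 * η ^ 2 * ∫ x, ρ x * fn u x ^ 2) = 2 * η * ∫ x, ρ x * fn u x ^ 2 := by
    field_simp
  have h4 := mul_le_mul_of_nonneg_left (hρ.integral_fn_sq_le u) (by positivity : 0 ≤ 4 * η)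
  linarith

/-- The right-hand side of the virial identity. -/
noncomputable def virial (n : ℕ) (σ : ℝ) (ρ : ℝ → ℝ) (u : H1) : ℝ :=
  ∫ x, ρ x * (σ * (fn u x ^ 2 + dx u x ^ 2) + 2 * (fn u x * fn (resolvent (nonlinearity n u)) x)
    - fn u x ^ 2 - 2 / (n + 3) * fn u x ^ (n + 3))

lemma IsWeight.integrable_linear (hρ : IsWeight ρ ρ' K) (σ : ℝ) (u f : H1) :
    Integrable fun x => ρ x * (σ * (fn u x ^ 2 + dx u x ^ 2) + 2 * (fn u x * fn f x)
      - fn u x ^ 2) := by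
  refine ((((hρ.integrable_energy u).const_mul σ).fun_add ((hρ.integrable_mul (memLp_fn u)
    (memLp_fn f)).const_mul 2)).sub (hρ.integrable_sq (memLp_fn u))).congr (ae_of_all _ fun x => ?_)
  simp only [Pi.sub_apply]; ring

lemma IsWeight.virial_eq (hρ : IsWeight ρ ρ' K) (n : ℕ) (σ : ℝ) (u : H1) :
    virial n σ ρ u = (∫ x, ρ x * (σ * (fn u x ^ 2 + dx u x ^ 2)
        + 2 * (fn u x * fn (resolvent (inclL2 u)) x) - fn u x ^ 2))
      + ∫ x, ρ x * (2 * (fn u x * fn (resolvent (powL2 (n + 1) u)) x)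
        - 2 / (n + 3) * fn u x ^ (n + 3)) := by
  have h0 := memLp_fn u
  have i2 : Integrable fun x => ρ x * (2 * (fn u x * fn (resolvent (powL2 (n + 1) u)) x)
        - 2 / (n + 3) * fn u x ^ (n + 3)) := by
    refine (((hρ.integrable_mul h0 (memLp_fn (resolvent (powL2 (n + 1) u)))).const_mul 2).sub
      ((hρ.integrable_mul (memLp_fn_pow u (n + 1)) h0).const_mul (2 / (n + 3)))).congr
      (ae_of_all _ fun x => ?_)
    simp only [Pi.sub_apply]; ring
  rw [virial, ← integral_add (hρ.integrable_linear σ u _) i2]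
  refine integral_congr_ae ?_
  have h1 := fn_add (resolvent (inclL2 u)) (resolvent (powL2 (n + 1) u))
  rw [← map_add] at h1
  filter_upwards [h1] with x hx
  rw [nonlinearity, hx]
  ring

/-- To the right of the light cone the virial form is negative definite. -/
theorem IsSlowWeight.virial_le (hρ : IsSlowWeight ρ ρ' K δ) (hδ0 : 0 ≤ δ) (hδ : δ ≤ 1 / 2)
    (n : ℕ) {u : H1} {η b σ : ℝ} (hη : 0 < η) (hu : ∀ᵐ x, |fn u x| ^ (n + 1) ≤ η)
    (hσ : σ ≤ -(1 + b)) :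
    virial n σ ρ u ≤ -(b - 2 * δ - 4 * η) * ∫ x, ρ x * (fn u x ^ 2 + dx u x ^ 2) := by
  set f := resolvent (inclL2 u)
  have hN := (abs_le.1 (hρ.abs_integral_nonlinear_le hδ n hη hu)).2
  have hR := hρ.integral_resolvent_sq_le (hδ.trans (by norm_num)) (inclL2 u)
  rw [coeFn_inclL2] at hR
  have i1 := (hρ.integrable_energy u).const_mul (-(1 + b))
  have i2 := hρ.integrable_sq (memLp_fn f)
  have h1 : ∫ x, ρ x * (σ * (fn u x ^ 2 + dx u x ^ 2) + 2 * (fn u x * fn f x) - fn u x ^ 2)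
      ≤ ∫ x, (-(1 + b) * (ρ x * (fn u x ^ 2 + dx u x ^ 2)) + ρ x * fn f x ^ 2) := by
    refine integral_mono (hρ.integrable_linear σ u f) (i1.add i2) fun x => ?_
    have e1 : σ * (fn u x ^ 2 + dx u x ^ 2) ≤ -(1 + b) * (fn u x ^ 2 + dx u x ^ 2) :=
      mul_le_mul_of_nonneg_right hσ (by positivity)
    have e2 : σ * (fn u x ^ 2 + dx u x ^ 2) + 2 * (fn u x * fn f x) - fn u x ^ 2
        ≤ -(1 + b) * (fn u x ^ 2 + dx u x ^ 2) + fn f x ^ 2 := by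
      nlinarith [sq_nonneg (fn u x - fn f x)]
    have := mul_le_mul_of_nonneg_left e2 (hρ.nonneg x)
    simp only
    linarith
  rw [integral_add i1 i2, integral_const_mul] at h1
  have hA := hρ.integral_fn_sq_le u
  have hf0 : 0 ≤ ∫ x, ρ x * fn f x ^ 2 :=
    integral_nonneg fun x => mul_nonneg (hρ.nonneg x) (sq_nonneg _)
  -- Here `1/(1 - δ) ≤ 1 + 2δ`, valid for `δ ≤ 1/2`.
  have hf : ∫ x, ρ x * fn f x ^ 2 ≤ (1 + 2 * δ) * ∫ x, ρ x * (fn u x ^ 2 + dx u x ^ 2) := by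
    have h2 := mul_le_mul_of_nonneg_left (hR.trans hA) (by linarith : 0 ≤ 1 + 2 * δ)
    nlinarith [mul_nonneg (mul_nonneg hδ0 (by linarith : 0 ≤ 1 - 2 * δ)) hf0]
  rw [hρ.virial_eq]
  linarith

/-- The discriminant `1 - 8a` is negative. The chosen `κ` makes the determinant `(a - κ)(2 - κ) -
1/4` of the shifted form equal to `κ²`, and completing the square finishes. -/
lemma quadratic_form_coercive {a : ℝ} (ha : 1 / 8 < a) :
    ∃ κ > 0, ∀ u f : ℝ, κ * (u ^ 2 + f ^ 2) ≤ a * u ^ 2 - u * f + 2 * f ^ 2 := by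
  refine ⟨(2 * a - 1 / 4) / (a + 2), div_pos (by linarith) (by linarith), fun u f => ?_⟩
  set κ := (2 * a - 1 / 4) / (a + 2) with hκ
  have h1 : κ * (a + 2) = 2 * a - 1 / 4 := div_mul_cancel₀ _ (by linarith)
  have h2 : 0 < a - κ := by nlinarith
  have h3 : 0 ≤ (a - κ) * (a * u ^ 2 - u * f + 2 * f ^ 2 - κ * (u ^ 2 + f ^ 2)) := by
    have : (a - κ) * (a * u ^ 2 - u * f + 2 * f ^ 2 - κ * (u ^ 2 + f ^ 2))
        = ((a - κ) * u - f / 2) ^ 2 + (2 * a - κ * (a + 2) + κ ^ 2 - 1 / 4) * f ^ 2 := by ring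
    rw [this, h1]
    have : (2 * a - (2 * a - 1 / 4) + κ ^ 2 - 1 / 4) * f ^ 2 = (κ * f) ^ 2 := by ring
    rw [this]
    positivity
  linarith [nonneg_of_mul_nonneg_right h3 h2]

/-- To the left of the line `x = -t/8` the virial form is positive definite. -/
theorem IsSlowWeight.le_virial (hρ : IsSlowWeight ρ ρ' K δ) (hδ : δ ≤ 1 / 2)
    (n : ℕ) {u : H1} {η a σ κ : ℝ} (hη : 0 < η) (hu : ∀ᵐ x, |fn u x| ^ (n + 1) ≤ η)
    (hκ : ∀ u f : ℝ, κ * (u ^ 2 + f ^ 2) ≤ a * u ^ 2 - u * f + 2 * f ^ 2)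
    (hδ0 : 0 ≤ δ) (hδκ : 2 * δ ≤ κ) (hσ : a ≤ σ) :
    (κ - δ - 4 * η) * (∫ x, ρ x * (fn u x ^ 2 + dx u x ^ 2)) ≤ virial n σ ρ u := by
  set f := resolvent (inclL2 u)
  set q := resolventDx (inclL2 u)
  have hN := (abs_le.1 (hρ.abs_integral_nonlinear_le hδ n hη hu)).1
  have z1 := integral_weight_mul_mul hρ.toIsWeight u q
  have z2 := integral_weight_mul_mul hρ.toIsWeight f q
  have iz1 := hρ.integrable_weight_mul_mul u q
  have iz2 := hρ.integrable_weight_mul_mul f q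
  have iL := hρ.integrable_linear σ u f
  -- The added terms are `-(ρ u q)'` and `2(ρ f q)'` with `q = f_x`, both of zero integral; they
  -- expose the coercive form in `(u, f)` and in `(u_x, f_x)`.
  have h1 : ∫ x, (κ - δ) * (ρ x * (fn u x ^ 2 + dx u x ^ 2))
      ≤ ∫ x, (ρ x * (σ * (fn u x ^ 2 + dx u x ^ 2) + 2 * (fn u x * fn f x) - fn u x ^ 2)
        - (ρ' x * (fn u x * fn q x) + ρ x * (dx u x * fn q x + fn u x * dx q x))
        + 2 * (ρ' x * (fn f x * fn q x) + ρ x * (dx f x * fn q x + fn f x * dx q x))) := by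
    refine integral_mono_ae ((hρ.integrable_energy u).const_mul _)
      ((iL.sub iz1).add (iz2.const_mul 2)) ?_
    filter_upwards [dx_resolventDx (inclL2 u)] with x hx
    have hx' : dx q x = fn f x - fn u x := hx
    have hq : fn q x = dx f x := rfl
    rw [hx', hq]
    set v := dx u x
    set g := dx f x
    have p1 := hκ (fn u x) (fn f x)
    have p2 := hκ v g
    have p3 : a * (fn u x ^ 2 + v ^ 2) ≤ σ * (fn u x ^ 2 + v ^ 2) :=
      mul_le_mul_of_nonneg_right hσ (by positivity)
    have p4 := (abs_le.1 (abs_two_mul_mul_le (hρ.abs_deriv_le_mul x) (fn u x) g)).2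
    have p5 := (abs_le.1 (abs_two_mul_mul_le (hρ.abs_deriv_le_mul x) (fn f x) g)).1
    have p6 := mul_nonneg (by linarith : 0 ≤ κ - 3 / 2 * δ)
      (by positivity : 0 ≤ fn f x ^ 2 + g ^ 2)
    have p7 := mul_nonneg hδ0 (by positivity : 0 ≤ fn u x ^ 2 / 2 + v ^ 2 + fn f x ^ 2 / 2)
    -- The `ρ'` terms cost at most `3δ/2` on `f² + g²`, absorbed by the surplus `κ(f² + g²)` since
    -- `2δ ≤ κ`; on `u²` they cost only `δ/2`.
    have p8 : (κ - δ) * (fn u x ^ 2 + v ^ 2) ≤ σ * (fn u x ^ 2 + v ^ 2)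
        - (fn u x * fn f x + v * g) + 2 * (fn f x ^ 2 + g ^ 2)
        - δ / 2 * (fn u x ^ 2 + g ^ 2) - δ * (fn f x ^ 2 + g ^ 2) := by
      linarith
    have p9 := mul_le_mul_of_nonneg_left p8 (hρ.nonneg x)
    linarith
  rw [integral_const_mul, integral_add (by exact iL.sub iz1) (iz2.const_mul 2), integral_sub iL iz1,
    integral_const_mul, z1, z2] at h1
  rw [hρ.virial_eq]
  linarith

end

/-! ### The weight `arctan (δ x)` -/

/-- The derivative of `arctan (δ x)`. -/
noncomputable def bump (δ x : ℝ) : ℝ := δ / (1 + (δ * x) ^ 2)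

/-- The second derivative of `arctan (δ x)`. -/
noncomputable def bumpDeriv (δ x : ℝ) : ℝ := -(2 * δ ^ 3 * x) / (1 + (δ * x) ^ 2) ^ 2

lemma hasDerivAt_arctan_mul (δ x : ℝ) :
    HasDerivAt (fun x => Real.arctan (δ * x)) (bump δ x) x := by
  have h := ((hasDerivAt_id x).const_mul δ).arctan
  simp only [id_eq, mul_one] at h
  convert! h using 1
  rw [bump]; ring

lemma hasDerivAt_bump (δ x : ℝ) : HasDerivAt (bump δ) (bumpDeriv δ x) x := by
  have h1 : HasDerivAt (fun x : ℝ => 1 + (δ * x) ^ 2) (2 * (δ * x) * δ) x := by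
    have := (((hasDerivAt_id x).const_mul δ).fun_pow 2).const_add 1
    simpa using this
  have h := (hasDerivAt_const x δ).fun_div h1 (by positivity)
  convert! h using 1
  rw [bumpDeriv]; ring

lemma continuous_bump (δ : ℝ) : Continuous (bump δ) :=
  continuous_iff_continuousAt.2 fun x => (hasDerivAt_bump δ x).continuousAt

lemma continuous_bumpDeriv (δ : ℝ) : Continuous (bumpDeriv δ) := by
  unfold bumpDeriv
  refine Continuous.div (by fun_prop) (by fun_prop) fun x => by positivity

lemma abs_arctan_le (x : ℝ) : |Real.arctan x| ≤ Real.pi / 2 :=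
  abs_le.2 ⟨(Real.neg_pi_div_two_lt_arctan x).le, (Real.arctan_lt_pi_div_two x).le⟩

lemma bump_nonneg {δ : ℝ} (hδ : 0 ≤ δ) (x : ℝ) : 0 ≤ bump δ x := by
  unfold bump; positivity

lemma bump_le {δ : ℝ} (hδ : 0 ≤ δ) (x : ℝ) : bump δ x ≤ δ :=
  div_le_self hδ (by nlinarith [sq_nonneg (δ * x)])

/-- The logarithmic derivative is `-2δy/(1 + y²)` with `y = δx`, and `|2y| ≤ 1 + y²`. -/
lemma abs_bumpDeriv_le {δ : ℝ} (hδ : 0 ≤ δ) (x : ℝ) : |bumpDeriv δ x| ≤ δ * bump δ x := by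
  have e : bumpDeriv δ x = -(2 * (δ * x) / (1 + (δ * x) ^ 2)) * (δ * bump δ x) := by
    unfold bumpDeriv bump
    field_simp
  have h : |-(2 * (δ * x) / (1 + (δ * x) ^ 2))| ≤ 1 := by
    rw [abs_neg, abs_div, abs_of_pos (by positivity : 0 < 1 + (δ * x) ^ 2),
      div_le_one (by positivity), abs_le]
    constructor <;> nlinarith [sq_nonneg (δ * x + 1), sq_nonneg (δ * x - 1)]
  have h0 : 0 ≤ δ * bump δ x := mul_nonneg hδ (bump_nonneg hδ x)
  rw [e, abs_mul, abs_of_nonneg h0]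
  exact mul_le_of_le_one_left h0 h

lemma isWeight_arctan {δ : ℝ} (hδ : 0 ≤ δ) (hδ1 : δ ≤ 1 / 2) :
    IsWeight (fun x => Real.arctan (δ * x)) (bump δ) 2 where
  hasDerivAt := hasDerivAt_arctan_mul δ
  continuous_deriv := continuous_bump δ
  abs_le x := (abs_arctan_le _).trans (by linarith [Real.pi_le_four])
  abs_deriv_le x := by
    rw [abs_of_nonneg (bump_nonneg hδ x)]
    linarith [bump_le hδ x]

lemma isSlowWeight_bump {δ : ℝ} (hδ : 0 ≤ δ) (hδ1 : δ ≤ 1 / 2) :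
    IsSlowWeight (bump δ) (bumpDeriv δ) 2 δ where
  hasDerivAt := hasDerivAt_bump δ
  continuous_deriv := continuous_bumpDeriv δ
  abs_le := (isWeight_arctan hδ hδ1).abs_deriv_le
  abs_deriv_le x := (abs_bumpDeriv_le hδ x).trans (by nlinarith [bump_le hδ x, bump_nonneg hδ x])
  nonneg := bump_nonneg hδ
  abs_deriv_le_mul := abs_bumpDeriv_le hδ

/-- The bump decays only quadratically, so it dominates every exponential without adjusting `δ`.
This keeps the smallness threshold independent of `c₀`. -/
lemma exp_le_bump {δ c₀ : ℝ} (hδ : 0 < δ) (hc : 0 < c₀) (x : ℝ) :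
    Real.exp (-c₀ * |x|) ≤ (1 + 2 * δ ^ 2 / c₀ ^ 2) / δ * bump δ x := by
  have h1 := Real.quadratic_le_exp_of_nonneg (by positivity : 0 ≤ c₀ * |x|)
  have h2 : 1 + (δ * x) ^ 2 ≤ (1 + 2 * δ ^ 2 / c₀ ^ 2) * Real.exp (c₀ * |x|) := by
    have e : 1 + (δ * x) ^ 2 = 1 + 2 * δ ^ 2 / c₀ ^ 2 * ((c₀ * |x|) ^ 2 / 2) := by
      rw [mul_pow c₀, sq_abs]; field_simp
    have h3 : 2 * δ ^ 2 / c₀ ^ 2 * ((c₀ * |x|) ^ 2 / 2)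
        ≤ 2 * δ ^ 2 / c₀ ^ 2 * Real.exp (c₀ * |x|) := by
      gcongr
      linarith [(by positivity : 0 ≤ c₀ * |x|)]
    have h4 : 1 ≤ Real.exp (c₀ * |x|) := Real.one_le_exp (by positivity)
    rw [e]
    linarith
  have e : (1 + 2 * δ ^ 2 / c₀ ^ 2) / δ * bump δ x
      = (1 + 2 * δ ^ 2 / c₀ ^ 2) / (1 + (δ * x) ^ 2) := by
    unfold bump; field_simp
  rw [e, le_div_iff₀ (by positivity), neg_mul, Real.exp_neg, inv_mul_le_iff₀ (Real.exp_pos _),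
    mul_comm (Real.exp _)]
  exact h2

/-! ### Consequences of a dissipative virial form -/

/-- The energy with the weight `arctan (δ (x + σ t + c))`. -/
noncomputable def arctanEnergy (δ σ c : ℝ) (u : ℝ → H1) (t : ℝ) : ℝ :=
  ∫ x, Real.arctan (δ * (x + (σ * t + c))) * (fn (u t) x ^ 2 + dx (u t) x ^ 2)

/-- The weighted virial form, multiplied by `-s`, controls the local energy along the lines
`x + σ t + c = 0`. -/
def Dissipative (n : ℕ) (δ κ s σ : ℝ) (u : ℝ → H1) : Prop :=
  ∀ c t, κ * (∫ x, bump δ (x + (σ * t + c)) * (fn (u t) x ^ 2 + dx (u t) x ^ 2))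
    ≤ -(s * virial n σ (fun x => bump δ (x + (σ * t + c))) (u t))

lemma integrable_energy (w : H1) : Integrable fun x => fn w x ^ 2 + dx w x ^ 2 :=
  (memLp_fn w).integrable_sq.add (memLp_dx w).integrable_sq

section

variable {n : ℕ} {u₀ : H1} {u : ℝ → H1} {δ κ s σ : ℝ}

lemma IsGlobalSolution.hasDerivAt_arctanEnergy (hu : IsGlobalSolution (n + 2) u₀ u) (hδ : 0 ≤ δ)
    (hδ1 : δ ≤ 1 / 2) (σ c t : ℝ) :
    HasDerivAt (arctanEnergy δ σ c u)
      (virial n σ (fun x => bump δ (x + (σ * t + c))) (u t)) t :=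
  hu.hasDerivAt_virial (isWeight_arctan hδ hδ1) (isSlowWeight_bump hδ hδ1).toIsWeight σ c t

lemma abs_arctanEnergy_le (hδ : 0 ≤ δ) (hδ1 : δ ≤ 1 / 2) (σ c : ℝ) (u : ℝ → H1) (t : ℝ) :
    |arctanEnergy δ σ c u t| ≤ 2 * ‖u t‖ ^ 2 := by
  rw [norm_sq_eq, ← integral_const_mul, arctanEnergy, ← Real.norm_eq_abs]
  refine norm_integral_le_of_norm_le ((integrable_energy (u t)).const_mul 2)
    (ae_of_all _ fun x => ?_)
  rw [norm_mul, Real.norm_of_nonneg (by positivity : 0 ≤ fn (u t) x ^ 2 + dx (u t) x ^ 2)]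
  exact mul_le_mul_of_nonneg_right ((isWeight_arctan hδ hδ1).abs_le _) (by positivity)

lemma integral_bump_energy_nonneg (hδ : 0 ≤ δ) (y : ℝ) (w : H1) :
    0 ≤ ∫ x, bump δ (x + y) * (fn w x ^ 2 + dx w x ^ 2) :=
  integral_nonneg fun x => mul_nonneg (bump_nonneg hδ _) (by positivity)

lemma Dissipative.antitone (hd : Dissipative n δ κ s σ u) (hu : IsGlobalSolution (n + 2) u₀ u)
    (hδ : 0 ≤ δ) (hδ1 : δ ≤ 1 / 2) (hκ : 0 ≤ κ) (c : ℝ) :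
    Antitone fun t => s * arctanEnergy δ σ c u t := by
  have h := fun t => (hu.hasDerivAt_arctanEnergy hδ hδ1 σ c t).const_mul s
  refine antitone_of_deriv_nonpos (fun t => (h t).differentiableAt) fun t => ?_
  rw [(h t).deriv]
  linarith [hd c t, mul_nonneg hκ (integral_bump_energy_nonneg hδ (σ * t + c) (u t))]

lemma lintegral_exp_energy_le {c₀ : ℝ} (hδ : 0 < δ) (hδ1 : δ ≤ 1 / 2) (hc : 0 < c₀) (y : ℝ)
    (w : H1) :
    ∫⁻ x, ENNReal.ofReal (Real.exp (-c₀ * |x + y|) * (fn w x ^ 2 + dx w x ^ 2))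
      ≤ ENNReal.ofReal ((1 + 2 * δ ^ 2 / c₀ ^ 2) / δ
        * ∫ x, bump δ (x + y) * (fn w x ^ 2 + dx w x ^ 2)) := by
  have hi := (((isSlowWeight_bump hδ.le hδ1).comp_add_const y).integrable_energy w).const_mul
    ((1 + 2 * δ ^ 2 / c₀ ^ 2) / δ)
  rw [← integral_const_mul, ofReal_integral_eq_lintegral_ofReal hi (ae_of_all _ fun x => ?_)]
  · refine lintegral_mono fun x => ENNReal.ofReal_le_ofReal ?_
    rw [← mul_assoc]
    exact mul_le_mul_of_nonneg_right (exp_le_bump hδ hc _) (by positivity)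
  · have := bump_nonneg hδ.le (x + y)
    simp only [Pi.zero_apply]
    positivity

theorem Dissipative.localEnergy_le (hd : Dissipative n δ κ s σ u)
    (hu : IsGlobalSolution (n + 2) u₀ u) (hs : |s| = 1) (hδ : 0 < δ) (hδ1 : δ ≤ 1 / 2) (hκ : 0 < κ)
    {c₀ : ℝ} (hc : 0 < c₀) :
    localEnergy c₀ σ u
      ≤ ENNReal.ofReal ((1 + 2 * δ ^ 2 / c₀ ^ 2) / δ / κ * 4 * ‖u₀‖ ^ 2) := by
  set D := (1 + 2 * δ ^ 2 / c₀ ^ 2) / δ / κ with hD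
  have hD0 : 0 < D := by positivity
  set V : ℝ → ℝ := fun t => -(s * virial n σ (fun x => bump δ (x + (σ * t + 0))) (u t)) with hV
  have hV0 : ∀ t, 0 ≤ V t := fun t =>
    (mul_nonneg hκ.le (integral_bump_energy_nonneg hδ.le _ (u t))).trans (hd 0 t)
  set H : ℝ → ℝ := fun t => D * -(s * arctanEnergy δ σ 0 u t) with hH
  have hH' : ∀ t, HasDerivAt H (D * V t) t := fun t =>
    ((hu.hasDerivAt_arctanEnergy hδ.le hδ1 σ 0 t).const_mul s).neg.const_mul D
  have hHb : ∀ t, |H t| ≤ D * (2 * ‖u₀‖ ^ 2) := fun t => by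
    rw [hH, abs_mul, abs_neg, abs_mul, hs, one_mul, abs_of_pos hD0, ← hu.norm_eq t]
    gcongr
    -- `H` is monotone and stays in an interval of length `4D‖u₀‖²`, which therefore bounds its
    -- total increase.
    exact abs_arctanEnergy_le hδ.le hδ1 σ 0 u t
  have hmono : Monotone H := monotone_of_deriv_nonneg (fun t => (hH' t).differentiableAt)
    fun t => by rw [(hH' t).deriv]; exact mul_nonneg hD0.le (hV0 t)
  have hbdd : BddAbove (Set.range H) := ⟨D * (2 * ‖u₀‖ ^ 2), by
    rintro _ ⟨t, rfl⟩
    exact (abs_le.1 (hHb t)).2⟩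
  have hlim := tendsto_atTop_ciSup hmono hbdd
  have hle : (⨆ t, H t) ≤ D * (2 * ‖u₀‖ ^ 2) := ciSup_le fun t => (abs_le.1 (hHb t)).2
  have hpos : ∀ t ∈ Set.Ioi (2 : ℝ), 0 ≤ D * V t := fun t _ => mul_nonneg hD0.le (hV0 t)
  have hint := integrableOn_Ioi_deriv_of_nonneg'
    (fun t (_ : t ∈ Set.Ici (2 : ℝ)) => hH' t) hpos hlim
  have hval := integral_Ioi_of_hasDerivAt_of_nonneg'
    (fun t (_ : t ∈ Set.Ici (2 : ℝ)) => hH' t) hpos hlim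
  calc localEnergy c₀ σ u ≤ ∫⁻ t in Set.Ioi (2 : ℝ), ENNReal.ofReal (D * V t) := by
        refine lintegral_mono fun t => ?_
        refine (lintegral_exp_energy_le hδ hδ1 hc (σ * t) (u t)).trans
          (ENNReal.ofReal_le_ofReal ?_)
        have h1 := mul_le_mul_of_nonneg_left (hd 0 t) hD0.le
        simp only [add_zero] at h1
        have h2 : (1 + 2 * δ ^ 2 / c₀ ^ 2) / δ = D * κ := by rw [hD]; field_simp
        rw [h2, mul_assoc]
        simpa only [hV, add_zero] using h1
    _ = ENNReal.ofReal (∫ t in Set.Ioi (2 : ℝ), D * V t) :=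
        (ofReal_integral_eq_lintegral_ofReal hint
          (ae_of_all _ fun t => mul_nonneg hD0.le (hV0 t))).symm
    _ ≤ _ := by
        refine ENNReal.ofReal_le_ofReal ?_
        rw [hval]
        linarith [(abs_le.1 (hHb 2)).1]

lemma integral_half_pi_add_arctan (δ s y : ℝ) (w : H1) :
    ∫ x, (Real.pi / 2 + s * Real.arctan (δ * (x + y))) * (fn w x ^ 2 + dx w x ^ 2)
      = Real.pi / 2 * ‖w‖ ^ 2
        + s * ∫ x, Real.arctan (δ * (x + y)) * (fn w x ^ 2 + dx w x ^ 2) := by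
  have i2 : Integrable fun x => Real.arctan (δ * (x + y)) * (fn w x ^ 2 + dx w x ^ 2) := by
    refine (integrable_energy w).bdd_mul (c := Real.pi / 2) ?_
      (ae_of_all _ fun x => abs_arctan_le _)
    exact (by fun_prop : Continuous fun x => Real.arctan (δ * (x + y))).aestronglyMeasurable
  rw [norm_sq_eq, ← integral_const_mul, ← integral_const_mul,
    ← integral_add ((integrable_energy w).const_mul _) (i2.const_mul _)]
  congr 1; ext x; ring

/-- The weight is bounded by `π` and vanishes pointwise as its centre leaves to the side fixed by
`s`; dominated convergence applies. -/
lemma tendsto_integral_half_pi_add_arctan (hδ : 0 < δ) (hs : s = 1 ∨ s = -1) {r : ℝ}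
    (hr : s * r < 0) (w : H1) :
    Tendsto (fun T : ℝ => ∫ x, (Real.pi / 2 + s * Real.arctan (δ * (x + r * T)))
      * (fn w x ^ 2 + dx w x ^ 2)) atTop (𝓝 0) := by
  have hs1 : |s| = 1 := by rcases hs with rfl | rfl <;> simp
  have h0 : (0 : ℝ) = ∫ x, (0 : ℝ) * (fn w x ^ 2 + dx w x ^ 2) := by simp
  rw [h0]
  refine tendsto_integral_filter_of_dominated_convergence
    (fun x => Real.pi * (fn w x ^ 2 + dx w x ^ 2)) (.of_forall fun T => ?_)
    (.of_forall fun T => ae_of_all _ fun x => ?_) ((integrable_energy w).const_mul _)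
    (ae_of_all _ fun x => ?_)
  · exact (by fun_prop : Continuous fun x => Real.pi / 2 + s * Real.arctan (δ * (x + r * T))
      ).aestronglyMeasurable.mul (integrable_energy w).aestronglyMeasurable
  · rw [norm_mul, Real.norm_of_nonneg (by positivity : 0 ≤ fn w x ^ 2 + dx w x ^ 2)]
    refine mul_le_mul_of_nonneg_right ((norm_add_le _ _).trans ?_) (by positivity)
    rw [norm_mul, Real.norm_eq_abs, Real.norm_eq_abs, Real.norm_eq_abs, hs1,
      abs_of_pos Real.pi_div_two_pos]
    linarith [abs_arctan_le (δ * (x + r * T))]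
  · refine Tendsto.mul_const _ ?_
    have hodd : ∀ y, s * Real.arctan y = Real.arctan (s * y) := fun y => by
      rcases hs with rfl | rfl <;> simp [Real.arctan_neg]
    simp_rw [hodd]
    have h1 : Tendsto (fun T : ℝ => s * (δ * (x + r * T))) atTop atBot := by
      have e : (fun T : ℝ => s * (δ * (x + r * T))) = fun T => s * δ * x + δ * (s * r) * T := by
        ext T; ring
      rw [e]
      exact tendsto_atBot_add_const_left _ _
        (tendsto_id.const_mul_atTop_of_neg (mul_neg_of_pos_of_neg hδ hr))
    have h2 := ((Real.tendsto_arctan_atBot.mono_right nhdsWithin_le_nhds).comp h1).const_add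
      (Real.pi / 2)
    simpa using h2

/-- The energy on the side of the line `x = -θ t` that a dissipative virial form at a different
velocity `σ` controls tends to zero. -/
theorem Dissipative.tendsto_normOn (hd : Dissipative n δ κ s σ u)
    (hu : IsGlobalSolution (n + 2) u₀ u) (hs : s = 1 ∨ s = -1) (hδ : 0 < δ) (hδ1 : δ ≤ 1 / 2)
    (hκ : 0 ≤ κ) {θ : ℝ} (hθ : s * (θ - σ) < 0) {S : ℝ → Set ℝ} (hS : ∀ T, MeasurableSet (S T))
    (hsub : ∀ T, ∀ x ∈ S T, 0 ≤ s * (x + θ * T)) :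
    Tendsto (fun T => normOn (S T) (u T)) atTop (𝓝 0) := by
  have key : ∀ T, 0 ≤ T → Real.pi / 2 * ∫ x in S T, (fn (u T) x ^ 2 + dx (u T) x ^ 2)
      ≤ ∫ x, (Real.pi / 2 + s * Real.arctan (δ * (x + (θ - σ) * T)))
        * (fn u₀ x ^ 2 + dx u₀ x ^ 2) := by
    intro T hT
    -- This shift centres the weight at `-θT` at time `T` and at `-(θ - σ)T` at time `0`. Norm
    -- conservation allows adding the constant `π/2`, which makes the weight nonnegative, and at
    -- least `π/2` on `S T`.
    have h1 := hd.antitone hu hδ.le hδ1 hκ ((θ - σ) * T) hT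
    simp only [arctanEnergy, hu.initial, mul_zero, zero_add] at h1
    have e1 : σ * T + (θ - σ) * T = θ * T := by ring
    rw [e1] at h1
    have hodd : ∀ y, s * Real.arctan y = Real.arctan (s * y) := fun y => by
      rcases hs with rfl | rfl <;> simp [Real.arctan_neg]
    have hnn : ∀ x, 0 ≤ Real.pi / 2 + s * Real.arctan (δ * (x + θ * T)) := fun x => by
      rw [hodd]
      linarith [Real.neg_pi_div_two_lt_arctan (s * (δ * (x + θ * T)))]
    have hi : Integrable fun x => (Real.pi / 2 + s * Real.arctan (δ * (x + θ * T)))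
        * (fn (u T) x ^ 2 + dx (u T) x ^ 2) := by
      refine (integrable_energy (u T)).bdd_mul (c := Real.pi) ?_ (ae_of_all _ fun x => ?_)
      · exact (by fun_prop : Continuous fun x =>
          Real.pi / 2 + s * Real.arctan (δ * (x + θ * T))).aestronglyMeasurable
      · rw [Real.norm_of_nonneg (hnn x), hodd]
        linarith [Real.arctan_lt_pi_div_two (s * (δ * (x + θ * T)))]
    calc Real.pi / 2 * ∫ x in S T, (fn (u T) x ^ 2 + dx (u T) x ^ 2)
        ≤ ∫ x in S T, (Real.pi / 2 + s * Real.arctan (δ * (x + θ * T)))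
          * (fn (u T) x ^ 2 + dx (u T) x ^ 2) := by
          rw [← integral_const_mul]
          refine setIntegral_mono_on ((integrable_energy _).const_mul _).integrableOn
            hi.integrableOn (hS T) fun x hx => ?_
          refine mul_le_mul_of_nonneg_right ?_ (by positivity)
          have h2 : 0 ≤ s * (δ * (x + θ * T)) := by
            have := mul_nonneg hδ.le (hsub T x hx)
            linarith
          rw [hodd]
          linarith [Real.arctan_nonneg.2 h2]
      _ ≤ ∫ x, (Real.pi / 2 + s * Real.arctan (δ * (x + θ * T)))
          * (fn (u T) x ^ 2 + dx (u T) x ^ 2) :=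
          setIntegral_le_integral hi (ae_of_all _ fun x => mul_nonneg (hnn x) (by positivity))
      _ ≤ _ := by
          rw [integral_half_pi_add_arctan, integral_half_pi_add_arctan, hu.norm_eq]
          linarith
  have hlim := (tendsto_integral_half_pi_add_arctan hδ hs hθ u₀).const_mul (2 / Real.pi)
  rw [mul_zero] at hlim
  have h0 : Tendsto (fun T => ∫ x in S T, (fn (u T) x ^ 2 + dx (u T) x ^ 2)) atTop (𝓝 0) := by
    refine tendsto_of_tendsto_of_tendsto_of_le_of_le' tendsto_const_nhds hlim
      (.of_forall fun T => integral_nonneg fun x => by positivity) ?_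
    filter_upwards [eventually_ge_atTop 0] with T hT
    have := mul_le_mul_of_nonneg_left (key T hT) (by positivity : 0 ≤ 2 / Real.pi)
    rw [← mul_assoc] at this
    have e : 2 / Real.pi * (Real.pi / 2) = 1 := by field_simp
    rwa [e, one_mul] at this
  simpa [normOn] using h0.sqrt

end

/-! ### Small solutions have a dissipative virial form -/

/-- The exponent `p - 1` is at least `1`, so a bound by `η ≤ 1` survives taking the power; norm
conservation makes it uniform in time. -/
lemma IsGlobalSolution.ae_abs_pow_le {n : ℕ} {u₀ : H1} {u : ℝ → H1}
    (hu : IsGlobalSolution (n + 2) u₀ u) {η : ℝ} (hη : η ≤ 1) (h : ‖u₀‖ < η) (t : ℝ) :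
    ∀ᵐ x, |fn (u t) x| ^ (n + 1) ≤ η := by
  filter_upwards [ae_abs_fn_le (u t)] with x hx
  rw [hu.norm_eq] at hx
  have h1 : |fn (u t) x| ≤ 1 := by linarith
  calc |fn (u t) x| ^ (n + 1) ≤ |fn (u t) x| ^ 1 :=
        pow_le_pow_of_le_one (abs_nonneg _) h1 (by omega)
    _ ≤ η := by rw [pow_one]; linarith

theorem exists_dissipative_right (n : ℕ) {b : ℝ} (hb : 0 < b) :
    ∃ ε > 0, ∃ δ > 0, δ ≤ 1 / 2 ∧ ∃ κ > 0, ∀ (u₀ : H1) (u : ℝ → H1), ‖u₀‖ < ε →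
      IsGlobalSolution (n + 2) u₀ u → ∀ σ ≤ -(1 + b), Dissipative n δ κ 1 σ u := by
  -- Budget: `2δ ≤ b/4` and `4η ≤ b/4` leave half of `b`.
  refine ⟨min 1 (b / 16), by positivity, min (1 / 2) (b / 8), by positivity, min_le_left _ _,
    b / 2, by positivity, fun u₀ u h0 hu σ hσ c t => ?_⟩
  have hη : (0 : ℝ) < min 1 (b / 16) := by positivity
  have hδ : (0 : ℝ) < min (1 / 2) (b / 8) := by positivity
  have h := ((isSlowWeight_bump hδ.le (min_le_left _ _)).comp_add_const (σ * t + c)).virial_le hδ.le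
    (min_le_left _ _) n hη (hu.ae_abs_pow_le (min_le_left _ _) h0 t) hσ
  have hE := integral_bump_energy_nonneg hδ.le (σ * t + c) (u t)
  have hk : b / 2 ≤ b - 2 * min (1 / 2) (b / 8) - 4 * min 1 (b / 16) := by
    linarith [min_le_right (1 / 2) (b / 8), min_le_right 1 (b / 16)]
  have := mul_le_mul_of_nonneg_right hk hE
  linarith

theorem exists_dissipative_left (n : ℕ) {a : ℝ} (ha : 1 / 8 < a) :
    ∃ ε > 0, ∃ δ > 0, δ ≤ 1 / 2 ∧ ∃ κ > 0, ∀ (u₀ : H1) (u : ℝ → H1), ‖u₀‖ < ε →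
      IsGlobalSolution (n + 2) u₀ u → ∀ σ ≥ a, Dissipative n δ κ (-1) σ u := by
  obtain ⟨κ, hκ, hq⟩ := quadratic_form_coercive ha
  -- Budget: `δ ≤ κ/2`, also the condition for absorbing the `ρ'` terms, and `4η ≤ κ/4` leave `κ/4`.
  refine ⟨min 1 (κ / 16), by positivity, min (1 / 2) (κ / 2), by positivity, min_le_left _ _,
    κ / 4, by positivity, fun u₀ u h0 hu σ hσ c t => ?_⟩
  have hη : (0 : ℝ) < min 1 (κ / 16) := by positivity
  have hδ : (0 : ℝ) < min (1 / 2) (κ / 2) := by positivity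
  have hδκ := min_le_right (1 / 2) (κ / 2)
  have h := ((isSlowWeight_bump hδ.le (min_le_left _ _)).comp_add_const (σ * t + c)).le_virial
    (min_le_left _ _) n hη (hu.ae_abs_pow_le (min_le_left _ _) h0 t) hq hδ.le (by linarith) hσ
  have hE := integral_bump_energy_nonneg hδ.le (σ * t + c) (u t)
  have hk : κ / 4 ≤ κ - min (1 / 2) (κ / 2) - 4 * min 1 (κ / 16) := by
    linarith [min_le_right 1 (κ / 16)]
  have := mul_le_mul_of_nonneg_right hk hE
  linarith

lemma tendsto_normOn_region {a b : ℝ} (ha : 0 < a) (hb : 0 < b) {u : ℝ → H1}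
    (h1 : Tendsto (fun t : ℝ => normOn (Set.Iio (-a * t)) (u t)) atTop (𝓝 0))
    (h2 : Tendsto (fun t : ℝ => normOn (Set.Ioi ((1 + b) * t)) (u t)) atTop (𝓝 0)) :
    Tendsto (fun t : ℝ => normOn (region a b t) (u t)) atTop (𝓝 0) := by
  have h3 := h1.add h2
  rw [add_zero] at h3
  refine tendsto_of_tendsto_of_tendsto_of_le_of_le' tendsto_const_nhds h3
    (.of_forall fun t => Real.sqrt_nonneg _) ?_
  filter_upwards [eventually_ge_atTop 0] with t ht
  have hdisj : Disjoint (Set.Iio (-a * t)) (Set.Ioi ((1 + b) * t)) := by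
    rw [Set.disjoint_left]
    intro x hx hx'
    simp only [Set.mem_Iio, Set.mem_Ioi] at hx hx'
    nlinarith [mul_nonneg ha.le ht, mul_nonneg hb.le ht]
  have hi := integrable_energy (u t)
  simp only [normOn, region]
  rw [setIntegral_union hdisj measurableSet_Ioi hi.integrableOn hi.integrableOn]
  set A := ∫ x in Set.Iio (-a * t), (fn (u t) x ^ 2 + dx (u t) x ^ 2) with hA
  set B := ∫ x in Set.Ioi ((1 + b) * t), (fn (u t) x ^ 2 + dx (u t) x ^ 2) with hB
  have hA0 : 0 ≤ A := integral_nonneg fun x => by positivity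
  have hB0 : 0 ≤ B := integral_nonneg fun x => by positivity
  refine Real.sqrt_le_iff.2 ⟨by positivity, ?_⟩
  nlinarith [Real.sq_sqrt hA0, Real.sq_sqrt hB0,
    mul_nonneg (Real.sqrt_nonneg A) (Real.sqrt_nonneg B)]

lemma ofReal_mul_norm_sq_le {D ε : ℝ} (hD : 0 ≤ D) {w : H1} (hw : ‖w‖ < ε) :
    ENNReal.ofReal (D * ‖w‖ ^ 2) ≤ ENNReal.ofReal (D * ε ^ 2) := by
  refine ENNReal.ofReal_le_ofReal (mul_le_mul_of_nonneg_left ?_ hD)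
  exact pow_le_pow_left₀ (norm_nonneg _) hw.le 2

end BBM

theorem theorem1 (p : ℕ) (hp : 2 ≤ p) (b : ℝ) (hb : 0 < b) :
    ∃ ε₁ : ℝ, 0 < ε₁ ∧
      -- the right half-line and `σ = -(1 + b)`: the smallness depends on `b` (and `p`) only
      (∀ (u₀ : BBM.H1) (u : ℝ → BBM.H1), ‖u₀‖ < ε₁ → BBM.IsGlobalSolution p u₀ u →
        Tendsto (fun t : ℝ => BBM.normOn (Set.Ioi ((1 + b) * t)) (u t)) atTop (𝓝 0)) ∧
      (∀ c₀ : ℝ, 0 < c₀ → ∃ C : ℝ, 0 < C ∧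
        ∀ (ε : ℝ) (u₀ : BBM.H1) (u : ℝ → BBM.H1), ε ≤ ε₁ → ‖u₀‖ < ε →
          BBM.IsGlobalSolution p u₀ u →
          BBM.localEnergy c₀ (-(1 + b)) u ≤ ENNReal.ofReal (C * ε ^ 2)) ∧
      -- the whole region and every `σ > 1/8`
      (∀ a : ℝ, 1 / 8 < a → ∃ ε₀ : ℝ, 0 < ε₀ ∧ ε₀ ≤ ε₁ ∧
        (∀ (u₀ : BBM.H1) (u : ℝ → BBM.H1), ‖u₀‖ < ε₀ → BBM.IsGlobalSolution p u₀ u →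
          Tendsto (fun t : ℝ => BBM.normOn (BBM.region a b t) (u t)) atTop (𝓝 0)) ∧
        (∀ c₀ : ℝ, 0 < c₀ → ∃ C : ℝ, 0 < C ∧
          ∀ (σ ε : ℝ) (u₀ : BBM.H1) (u : ℝ → BBM.H1), a ≤ σ → ε ≤ ε₀ → ‖u₀‖ < ε →
            BBM.IsGlobalSolution p u₀ u →
            BBM.localEnergy c₀ σ u ≤ ENNReal.ofReal (C * ε ^ 2))) := by

  obtain ⟨n, rfl⟩ : ∃ n, p = n + 2 := ⟨p - 2, by omega⟩
  -- Halving `b` gives dissipation already at `σ = -(1 + b/2)`, the strict velocity gap that the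
  -- limit on `x > (1 + b)t` requires.
  obtain ⟨ε₁, hε₁, δ, hδ, hδ1, κ, hκ, hR⟩ := BBM.exists_dissipative_right n (half_pos hb)
  have hright : ∀ (u₀ : BBM.H1) (u : ℝ → BBM.H1), ‖u₀‖ < ε₁ → BBM.IsGlobalSolution (n + 2) u₀ u →
      Tendsto (fun t : ℝ => BBM.normOn (Set.Ioi ((1 + b) * t)) (u t)) atTop (𝓝 0) := by
    intro u₀ u h0 hu
    refine (hR u₀ u h0 hu _ le_rfl).tendsto_normOn hu (.inl rfl) hδ hδ1 hκ.le (θ := -(1 + b))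
      (by linarith) (fun T => measurableSet_Ioi) fun T x hx => ?_
    simp only [Set.mem_Ioi] at hx
    linarith
  refine ⟨ε₁, hε₁, hright, fun c₀ hc => ⟨(1 + 2 * δ ^ 2 / c₀ ^ 2) / δ / κ * 4, by positivity, ?_⟩,
    fun a ha => ?_⟩
  · intro ε u₀ u hε h0 hu
    exact ((hR u₀ u (h0.trans_le hε) hu _ (by linarith)).localEnergy_le hu (by simp) hδ hδ1 hκ
      hc).trans (BBM.ofReal_mul_norm_sq_le (by positivity) h0)
  -- The midpoint between `1/8` and `a` plays the same role on the left; its constants serve all `σ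
  -- ≥ a` at once.
  · obtain ⟨ε₂, hε₂, δ', hδ', hδ1', κ', hκ', hL⟩ :=
      BBM.exists_dissipative_left n (by linarith : 1 / 8 < (a + 1 / 8) / 2)
    refine ⟨min ε₁ ε₂, lt_min hε₁ hε₂, min_le_left _ _, fun u₀ u h0 hu => ?_,
      fun c₀ hc => ⟨(1 + 2 * δ' ^ 2 / c₀ ^ 2) / δ' / κ' * 4, by positivity, ?_⟩⟩
    · refine BBM.tendsto_normOn_region (by linarith) hb ?_
        (hright u₀ u (h0.trans_le (min_le_left _ _)) hu)
      refine (hL u₀ u (h0.trans_le (min_le_right _ _)) hu _ le_rfl).tendsto_normOn hu (.inr rfl)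
        hδ' hδ1' hκ'.le (θ := a) (by linarith) (fun T => measurableSet_Iio) fun T x hx => ?_
      simp only [Set.mem_Iio] at hx
      linarith
    · intro σ ε u₀ u hσ hε h0 hu
      have h1 := (h0.trans_le hε).trans_le (min_le_right _ _)
      exact ((hL u₀ u h1 hu σ (by linarith)).localEnergy_le hu (by simp) hδ' hδ1' hκ'
        hc).trans (BBM.ofReal_mul_norm_sq_le (by positivity) h0)
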